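/- Let $W$ be an irreducible affine Weyl group with finite set $S$ of simple reflections and length function $w\mapsto |w|$; that is, $(W,S)$ is a Coxeter system with connected Coxeter graph whose canonical bilinear form is positive semidefinite and degenerate, so that $W$ acts as a group of affine transformations on an affine hyperplane of the dual of its geometric representation. Let $\mathcal T\subset W$ be the subgroup of elements that act as translations. Let $J\subsetneq S$ be a proper subset such that $W=W_J\mathcal T$, where $W_J$ is the subgroup generated by $J$. Then $W_J$ is finite; let $w_J$ be its longest element. There is a unique automorphism $w\mapsto w^*$ of $W$ such that $w^*=w_Jww_J$ for $w\in W_J$ and $t^*=w_Jt^{-1}w_J$ for $t\in\mathcal T$; it has square $1$ and preserves $S$ and $J$. Let $\mathbf I_*=\{w\in W: w^*=w^{-1}\}$, and let $M_0$ be the free abelian group with basis $\{a_x: x\in\mathbf I_*\}$. For $s\in S$ define $T_s: M_0\to M_0$ by $T_sa_x=a_{sx}$ if $|sx|>|x|$ and $sx=xs^*$; $T_sa_x=a_{sxs^*}$ if $|sx|>|x|$ and $sx\neq xs^*$; $T_sa_x=-a_x$ if $|sx|<|x|$. For a reduced expression $w=s_1\cdots s_k$ put $T_w=T_{s_1}\cdots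 T_{s_k}$, and define $\pi:W\to\mathbf I_*$ by $T_wa_1=\pm a_{\pi(w)}$. Put $${}^JW=\{w: |w|=|w_J|+|w_Jw|\},\quad W^J=\{w:|w|=|w_J|+|ww_J|\},\quad {}^JW^J={}^JW\cap W^J,$$ $$\mathcal T_{dom}=\{t\in\mathcal T: |w_Jt|=|w_J|+|t|\}.$$ Then ${}^JW^J\subset\mathbf I_*$, and $\pi$ restricts to a map ${}^J\pi:{}^JW\to{}^JW^J$. For each $t\in\mathcal T$ there is a unique $[t]\in{}^JW$ with $W_Jt=W_J[t]$; the maps $\mathcal T\to{}^JW$, $t\mapsto[t]$, and $\mathcal T_{dom}\to{}^JW^J$, $t\mapsto w_Jt$, are bijections. Under these bijections ${}^J\pi$ becomes a surjective map $\pi':\mathcal T\to\mathcal T_{dom}$. For every $t\in\mathcal T_{dom}$ we have ${}^J\pi(w_Jt)=w_Jt^2$, and hence $\pi'(t)=t^2$. -/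

import Mathlib

/-! ### Irreducible affine Coxeter matrices and the geometric representation -/

namespace CoxeterMatrix

variable {B : Type*} (M : CoxeterMatrix B)

/-- The Coxeter graph: distinct `i`, `j` are joined iff `s i` and `s j` do not commute. -/
def graph : SimpleGraph B where
  Adj i j := i ≠ j ∧ M i j ≠ 2
  symm := ⟨fun i j h => ⟨h.1.symm, by rw [M.symmetric]; exact h.2⟩⟩
  loopless := ⟨fun _ h => h.1 rfl⟩

/-- The matrix `-cos (π / m i j)` of the canonical bilinear form in the basis of simple roots.
The value `m i j = 0` encodes `∞`; as `π / 0 = 0` in Lean, the entry is then `-1`, as it should. -/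
noncomputable def cosMatrix : Matrix B B ℝ :=
  Matrix.of fun i j => -Real.cos (Real.pi / (M i j : ℝ))

/-- `M` is the Coxeter matrix of an irreducible affine Weyl group: its graph is connected, and its
canonical form is positive semidefinite and degenerate. -/
structure IsIrreducibleAffine : Prop where
  connected : M.graph.Connected
  posSemidef : M.cosMatrix.PosSemidef
  not_posDef : ¬ M.cosMatrix.PosDef

theorem cosMatrix_self (i : B) : M.cosMatrix i i = 1 := by
  simp [cosMatrix]

theorem cosMatrix_symm (i j : B) : M.cosMatrix i j = M.cosMatrix j i := by
  simp [cosMatrix, M.symmetric i j]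

variable [Fintype B]

/-- The linear form `v ↦ 2 (α i, v)`, where `( , )` is the canonical form. -/
noncomputable def simpleCoroot (i : B) : Module.Dual ℝ (B → ℝ) :=
  (2 : ℝ) • (LinearMap.proj i ∘ₗ M.cosMatrix.mulVecLin)

theorem simpleCoroot_apply (i : B) (v : B → ℝ) :
    M.simpleCoroot i v = 2 * M.cosMatrix.mulVec v i := by
  simp [simpleCoroot]

/-- The affine space on which the Weyl group acts: the linear forms on the span of the simple roots
whose restriction to the radical of the canonical form is the restriction of the sum of the
coordinates. In the affine case the radical is a line spanned by a vector with positive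
coordinates, so this is an affine hyperplane in the dual space, and the points of it that are
positive at all simple roots form the open fundamental alcove. -/
def affineSpace : Set (Module.Dual ℝ (B → ℝ)) :=
  {f | ∀ δ : B → ℝ, M.cosMatrix.mulVec δ = 0 → f δ = ∑ i, δ i}

variable [DecidableEq B]

theorem simpleCoroot_single (i j : B) :
    M.simpleCoroot i (Pi.single j 1) = 2 * M.cosMatrix i j := by
  simp [simpleCoroot_apply]

theorem simpleCoroot_self (i : B) : M.simpleCoroot i (Pi.single i 1) = 2 := by
  rw [simpleCoroot_single, cosMatrix_self, mul_one]

/-- The reflection `v ↦ v - 2 (α i, v) α i`, where the simple root `α i` is the `i`-th standard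
basis vector of `B → ℝ`. -/
noncomputable def simpleReflection (i : B) : (B → ℝ) ≃ₗ[ℝ] (B → ℝ) :=
  Module.reflection (M.simpleCoroot_self i)

theorem simpleReflection_isLiftable : M.IsLiftable M.simpleReflection := by
  intro i j
  by_cases hij : i = j
  · subst hij
    rw [M.diagonal, pow_one]
    ext1 v
    exact Module.involutive_reflection (M.simpleCoroot_self i) v
  · rcases Nat.eq_zero_or_pos (M i j) with h0 | hpos
    · rw [h0, pow_zero]
    have hne1 : M i j ≠ 1 := M.off_diagonal i j hij
    ext1 v
    rw [simpleReflection, simpleReflection, Module.reflection_mul_reflection_pow_apply]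
    rw [simpleCoroot_single, simpleCoroot_single, M.cosMatrix_symm j i]
    set m : ℕ := M i j with hm
    have hc : M.cosMatrix i j = -Real.cos (Real.pi / (m : ℝ)) := rfl
    rw [hc]
    have hmR : (0 : ℝ) < m := by exact_mod_cast hpos
    set θ : ℝ := Real.pi / (m : ℝ) with hθ
    have hmθ : (m : ℝ) * θ = Real.pi := by rw [hθ]; field_simp
    have ht : 2 * -Real.cos θ * (2 * -Real.cos θ) - 2 = 2 * Real.cos (2 * θ) := by
      rw [Real.cos_two_mul]; ring
    rw [ht]
    by_cases h2 : m = 2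
    · have hcos : Real.cos θ = 0 := by rw [hθ, h2]; simp
      have hcos2 : Real.cos (2 * θ) = -1 := by rw [Real.cos_two_mul, hcos]; norm_num
      simp only [h2, hcos, hcos2]
      norm_num
      module
    · have hm3 : 3 ≤ m := by omega
      have hsin : Real.sin (2 * θ) ≠ 0 := by
        apply ne_of_gt
        have h3 : (3 : ℝ) ≤ m := by exact_mod_cast hm3
        have hθpos : 0 < θ := by rw [hθ]; positivity
        apply Real.sin_pos_of_pos_of_lt_pi (by linarith)
        nlinarith
      have hS : ∀ k : ℤ, ((Polynomial.Chebyshev.S ℝ k).eval (2 * Real.cos (2 * θ))) *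
          Real.sin (2 * θ) = Real.sin ((k + 1) * (2 * θ)) :=
        fun k => Polynomial.Chebyshev.S_two_mul_real_cos (2 * θ) k
      rcases Nat.even_or_odd' m with ⟨k, hk | hk⟩
      · have e1 : ((m : ℤ) - 2) / 2 = k - 1 := by omega
        have e2 : ((m : ℤ) - 1) / 2 = k - 1 := by omega
        have hz : (Polynomial.Chebyshev.S ℝ ((k : ℤ) - 1)).eval (2 * Real.cos (2 * θ)) = 0 := by
          refine (mul_eq_zero.mp ((hS _).trans ?_)).resolve_right hsin
          have : (((k : ℤ) - 1 : ℤ) + 1 : ℝ) * (2 * θ) = Real.pi := by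
            rw [← hmθ, hk]; push_cast; ring
          rw [this, Real.sin_pi]
        rw [e1, e2, hz]
        simp
      · have e1 : ((m : ℤ) - 2) / 2 = k - 1 := by omega
        have e2 : ((m : ℤ) - 1) / 2 = k := by omega
        have e3 : ((m : ℤ) - 3) / 2 = k - 1 := by omega
        have e4 : (m : ℤ) / 2 = k := by omega
        have hz : (Polynomial.Chebyshev.S ℝ (k : ℤ)).eval (2 * Real.cos (2 * θ)) +
            (Polynomial.Chebyshev.S ℝ ((k : ℤ) - 1)).eval (2 * Real.cos (2 * θ)) = 0 := by
          refine (mul_eq_zero.mp ?_).resolve_right hsin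
          rw [add_mul, hS, hS]
          have h1 : (((k : ℤ) : ℝ) + 1) * (2 * θ) = θ + Real.pi := by
            rw [← hmθ, hk]; push_cast; ring
          have h2 : (((k : ℤ) - 1 : ℤ) + 1 : ℝ) * (2 * θ) = Real.pi - θ := by
            rw [← hmθ, hk]; push_cast; ring
          rw [h1, h2, Real.sin_add_pi, Real.sin_pi_sub]; ring
        rw [e1, e2, e3, e4, hz]
        simp

end CoxeterMatrix

namespace CoxeterSystem

variable {B W : Type*} [Group W] {M : CoxeterMatrix B} (cs : CoxeterSystem M W)

/-! ### Translations -/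

section Translations

variable [Fintype B] [DecidableEq B]

/-- The geometric representation of a Coxeter group. -/
noncomputable def geometricRep : W →* ((B → ℝ) ≃ₗ[ℝ] (B → ℝ)) :=
  cs.lift ⟨M.simpleReflection, M.simpleReflection_isLiftable⟩

/-- The contragredient action of a Coxeter group on the dual of the geometric representation. -/
noncomputable def dualAct (w : W) (f : Module.Dual ℝ (B → ℝ)) : Module.Dual ℝ (B → ℝ) :=
  f ∘ₗ (cs.geometricRep w⁻¹).toLinearMap

theorem geometricRep_radical (w : W) (δ : B → ℝ) (hδ : M.cosMatrix.mulVec δ = 0) :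
    cs.geometricRep w δ = δ := by
  induction w using cs.simple_induction with
  | simple i =>
    rw [geometricRep, lift_apply_simple, CoxeterMatrix.simpleReflection, Module.reflection_apply,
      CoxeterMatrix.simpleCoroot_apply, hδ]
    simp
  | one => simp
  | mul w w' h h' => rw [map_mul, LinearEquiv.mul_apply, h', h]

theorem dualAct_mem (w : W) {f : Module.Dual ℝ (B → ℝ)} (hf : f ∈ M.affineSpace) :
    cs.dualAct w f ∈ M.affineSpace := by
  intro δ hδ
  have h := cs.geometricRep_radical w⁻¹ δ hδ
  simp only [dualAct, LinearMap.comp_apply, LinearEquiv.coe_coe, h]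
  exact hf δ hδ

theorem dualAct_one (f : Module.Dual ℝ (B → ℝ)) : cs.dualAct 1 f = f := by
  ext v; simp [dualAct]

theorem dualAct_mul (w w' : W) (f : Module.Dual ℝ (B → ℝ)) :
    cs.dualAct (w * w') f = cs.dualAct w (cs.dualAct w' f) := by
  ext v; simp [dualAct]

/-- The subgroup of translations: the elements that act on the affine space `M.affineSpace` by
adding a fixed vector. -/
def translations : Subgroup W where
  carrier := {w | ∃ u : Module.Dual ℝ (B → ℝ), ∀ f ∈ M.affineSpace, cs.dualAct w f = f + u}
  one_mem' := ⟨0, fun f _ => by rw [dualAct_one, add_zero]⟩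
  mul_mem' := by
    rintro w w' ⟨u, hu⟩ ⟨u', hu'⟩
    refine ⟨u' + u, fun f hf => ?_⟩
    rw [dualAct_mul, hu _ (cs.dualAct_mem w' hf), hu' f hf, add_assoc]
  inv_mem' := by
    rintro w ⟨u, hu⟩
    refine ⟨-u, fun f hf => ?_⟩
    have h := hu _ (cs.dualAct_mem w⁻¹ hf)
    rw [← dualAct_mul, mul_inv_cancel, dualAct_one] at h
    nth_rewrite 2 [h]
    rw [add_neg_cancel_right]

end Translations

/-! ### Parabolic subgroups -/

/-- The subgroup `W_J` generated by the simple reflections in `J`. -/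
def parabolic (J : Set B) : Subgroup W := Subgroup.closure (cs.simple '' J)

/-- The element `w_J` of maximal length of `W_J` (meaningful if `W_J` is finite). -/
noncomputable def longest (J : Set B) : W :=
  Classical.epsilon fun w => w ∈ cs.parabolic J ∧ ∀ v ∈ cs.parabolic J, cs.length v ≤ cs.length w

/-- The set `{w | |w| = |w_J| + |w_J w|}`. -/
def leftMaximal (J : Set B) : Set W :=
  {w | cs.length w = cs.length (cs.longest J) + cs.length (cs.longest J * w)}

/-- The set `{w | |w| = |w_J| + |w w_J|}`. -/
def rightMaximal (J : Set B) : Set W :=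
  {w | cs.length w = cs.length (cs.longest J) + cs.length (w * cs.longest J)}

/-! ### Twisted involutions and the map `π` -/

/-- An automorphism of the group with square `1` that preserves the set of simple reflections. -/
structure DiagramInvolution extends W ≃* W where
  involutive : ∀ w, toMulEquiv (toMulEquiv w) = w
  map_simple : ∀ i, ∃ j, toMulEquiv (cs.simple i) = cs.simple j

variable {cs}

namespace DiagramInvolution

variable (σ : cs.DiagramInvolution)

/-- The set of twisted involutions, `{w | w^* = w⁻¹}`. -/
def twistedInvolutions : Set W := {w | σ.toMulEquiv w = w⁻¹}

theorem one_mem : (1 : W) ∈ σ.twistedInvolutions := by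
  simp [twistedInvolutions]

theorem simple_mul_mem (i : B) {x : W} (hx : x ∈ σ.twistedInvolutions)
    (h : cs.simple i * x = x * σ.toMulEquiv (cs.simple i)) :
    cs.simple i * x ∈ σ.twistedInvolutions := by
  have hx' : σ.toMulEquiv x = x⁻¹ := hx
  change σ.toMulEquiv (cs.simple i * x) = (cs.simple i * x)⁻¹
  rw [h, map_mul, hx', σ.involutive, ← h, mul_inv_rev, cs.inv_simple]

theorem simple_mul_mul_mem (i : B) {x : W} (hx : x ∈ σ.twistedInvolutions) :
    cs.simple i * x * σ.toMulEquiv (cs.simple i) ∈ σ.twistedInvolutions := by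
  have hx' : σ.toMulEquiv x = x⁻¹ := hx
  change σ.toMulEquiv _ = _⁻¹
  rw [map_mul, map_mul, hx', σ.involutive, mul_inv_rev, mul_inv_rev, cs.inv_simple, ← map_inv,
    cs.inv_simple, mul_assoc]

open Classical in
/-- The operator `T_s`, `s = s i`, of the nil-Hecke algebra on the free abelian group `M₀` with
basis `a_x`, `x` a twisted involution: `T_s a_x = a_{sx}` if `|sx| > |x|` and `sx = xs^*`;
`T_s a_x = a_{sxs^*}` if `|sx| > |x|` and `sx ≠ xs^*`; `T_s a_x = -a_x` if `|sx| < |x|`. -/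
noncomputable def nilHeckeSimple (i : B) :
    (σ.twistedInvolutions →₀ ℤ) →ₗ[ℤ] (σ.twistedInvolutions →₀ ℤ) :=
  Finsupp.linearCombination ℤ fun x : σ.twistedInvolutions =>
    if cs.length x < cs.length (cs.simple i * x) then
      if h : cs.simple i * x = x * σ.toMulEquiv (cs.simple i) then
        Finsupp.single ⟨cs.simple i * x, σ.simple_mul_mem i x.2 h⟩ 1
      else
        Finsupp.single
          ⟨cs.simple i * x * σ.toMulEquiv (cs.simple i), σ.simple_mul_mul_mem i x.2⟩ 1
    else - Finsupp.single x 1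

/-- The operator `T_w = T_{s₁} ⋯ T_{sₖ}` on `M₀`, where `w = s₁ ⋯ sₖ` is a reduced expression. (The
`T_s` satisfy the braid relations, so the choice of the reduced expression does not matter.) -/
noncomputable def nilHecke (w : W) :
    (σ.twistedInvolutions →₀ ℤ) →ₗ[ℤ] (σ.twistedInvolutions →₀ ℤ) :=
  (((Classical.choose (cs.exists_isReduced w)).map σ.nilHeckeSimple).prod :
    Module.End ℤ (σ.twistedInvolutions →₀ ℤ))

theorem exists_nilHecke_one (w : W) : ∃ x : σ.twistedInvolutions,
    σ.nilHecke w (Finsupp.single ⟨1, σ.one_mem⟩ 1) = Finsupp.single x 1 ∨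
      σ.nilHecke w (Finsupp.single ⟨1, σ.one_mem⟩ 1) = - Finsupp.single x 1 := by
  unfold nilHecke
  induction Classical.choose (cs.exists_isReduced w) with
  | nil => exact ⟨⟨1, σ.one_mem⟩, Or.inl (by simp)⟩
  | cons i ω ih =>
    obtain ⟨x, hx⟩ := ih
    have key : ∃ y : σ.twistedInvolutions,
        σ.nilHeckeSimple i (Finsupp.single x 1) = Finsupp.single y 1 ∨
          σ.nilHeckeSimple i (Finsupp.single x 1) = - Finsupp.single y 1 := by
      simp only [nilHeckeSimple, Finsupp.linearCombination_single, one_smul]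
      split_ifs
      · exact ⟨_, Or.inl rfl⟩
      · exact ⟨_, Or.inl rfl⟩
      · exact ⟨x, Or.inr rfl⟩
    obtain ⟨y, hy⟩ := key
    refine ⟨y, ?_⟩
    rw [List.map_cons, List.prod_cons, Module.End.mul_apply]
    rcases hx with hx | hx <;> rw [hx]
    · exact hy
    · rw [map_neg]
      rcases hy with hy | hy <;> rw [hy]
      · exact Or.inr rfl
      · exact Or.inl (neg_neg _)

/-- The map `π` from the group to the set of twisted involutions: `π w` is the (unique) `x` with
`T_w a_1 = ± a_x`. -/
noncomputable def pi (w : W) : σ.twistedInvolutions :=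
  Classical.choose (σ.exists_nilHecke_one w)

end DiagramInvolution

/-! ### The affine case -/

variable (cs) [Fintype B] [DecidableEq B]

/-- The condition that characterizes the automorphism `*` attached to `J`: `w^* = w_J w w_J` for `w`
in `W_J`, and `t^* = w_J t⁻¹ w_J` for every translation `t`. -/
def IsOpposition (J : Set B) (e : W ≃* W) : Prop :=
  (∀ w ∈ cs.parabolic J, e w = cs.longest J * w * cs.longest J) ∧
    ∀ t ∈ cs.translations, e t = cs.longest J * t⁻¹ * cs.longest J

/-- The set of dominant translations, `{t | |w_J t| = |w_J| + |t|}`. -/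
def dominantTranslations (J : Set B) : Set W :=
  {t | t ∈ cs.translations ∧
    cs.length (cs.longest J * t) = cs.length (cs.longest J) + cs.length t}

end CoxeterSystem

/-! Write `∘` for the Demazure product, the associative product on `W` in which `s ∘ x` is the
longer of `x` and `sx`. Up to sign, `T_s` sends `a_x` to the basis element of `s ∘ x ∘ s^*`.
Iterating gives `π(w) = w ∘ (w^*)⁻¹` (`pi_eq_demazureSquare`), and everything about `π` follows from
this formula.

For `t` dominant, `(w_J t)^* = (w_J t)⁻¹`, so `π(w_J t) = (w_J t) ∘ (w_J t)`. The left factor is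
`(w_J t w_J) ∘ w_J` and the right one is `w_J ∘ t`. As `w_J ∘ w_J = w_J`, one copy of `w_J`
disappears and there remains `w_J ∘ t ∘ t`. This equals `w_J t²` because `|t²| = 2|t|` and `t²` is
again dominant (`demazureSquare_longest_mul`). Surjectivity: every twisted involution is `v ∘
(v^*)⁻¹` for some `v`. If it absorbs `w_J` on both sides, then `v` can be replaced by `w_J ∘ v`,
which lies in `^JW`.

The geometric input is that each root is nonnegative or nonpositive (`geometricRep_single_nonneg`),
so that additivity of lengths becomes a statement about inverted roots. In the affine case the
radical is spanned by a positive vector `δ`, and a translation acts by `v ↦ v + c(v) δ`. The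
hypothesis `W = W_J 𝒯` forces `J` to omit exactly one index `o`. The automorphism `*` is conjugation
by `v ↦ 2 v_o δ - w_J v`, which permutes the simple roots. -/

/-! ### Roots and lengths -/

namespace CoxeterSystem

variable {B W : Type*} [Group W] {M : CoxeterMatrix B} (cs : CoxeterSystem M W)

/-- Stripping from the right letters of a rank two parabolic subgroup. -/
theorem exists_eq_mul_alternatingWord (w : W) (i j : B) (hi : ¬ cs.IsRightDescent w i) :
    ∃ (v : W) (n : ℕ), w = v * cs.wordProd (alternatingWord i j n) ∧
      cs.length w = cs.length v + n ∧ ¬ cs.IsRightDescent v i ∧ ¬ cs.IsRightDescent v j := by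
  induction h : cs.length w generalizing w i j with
  | zero =>
    have h1 := cs.length_eq_zero_iff.mp h
    subst h1
    exact ⟨1, 0, by simp [alternatingWord], by simp, cs.not_isRightDescent_one i,
      cs.not_isRightDescent_one j⟩
  | succ k ih =>
    by_cases hj : cs.IsRightDescent w j
    · have hj' := cs.isRightDescent_iff.mp hj
      obtain ⟨v, n, h1, h2, h3, h4⟩ := ih (w * cs.simple j) j i
        (cs.isRightDescent_iff_not_isRightDescent_mul.mp hj) (by omega)
      refine ⟨v, n + 1, ?_, by omega, h4, h3⟩
      rw [alternatingWord_succ, wordProd_concat, ← mul_assoc, ← h1,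
        simple_mul_simple_cancel_right]
    · exact ⟨w, 0, by simp [alternatingWord], by simp [h], hi, hj⟩

/-- The coefficients of the roots of a dihedral group. -/
noncomputable def dihedralCoeff (m n : ℕ) : ℝ :=
  if m = 0 then n else Real.sin (n * (Real.pi / m)) / Real.sin (Real.pi / m)

theorem dihedralCoeff_zero (m : ℕ) : dihedralCoeff m 0 = 0 := by
  simp [dihedralCoeff]

theorem sin_pi_div_pos {m : ℕ} (hm : 2 ≤ m) : 0 < Real.sin (Real.pi / m) := by
  have : (2 : ℝ) ≤ m := by exact_mod_cast hm
  apply Real.sin_pos_of_pos_of_lt_pi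
  · positivity
  · rw [div_lt_iff₀ (by linarith)]
    nlinarith [Real.pi_pos]

theorem dihedralCoeff_one {m : ℕ} (hm : m ≠ 1) : dihedralCoeff m 1 = 1 := by
  unfold dihedralCoeff
  split_ifs with h
  · simp
  · have := sin_pi_div_pos (m := m) (by omega)
    simp [this.ne']

/-- This is the recurrence by which the coefficients change when two simple reflections are applied
alternately to a simple root. -/
theorem dihedralCoeff_add_two {m : ℕ} (hm : m ≠ 1) (n : ℕ) :
    dihedralCoeff m (n + 2) =
      2 * Real.cos (Real.pi / m) * dihedralCoeff m (n + 1) - dihedralCoeff m n := by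
  unfold dihedralCoeff
  split_ifs with h
  · subst h; simp; ring
  · have := sin_pi_div_pos (m := m) (by omega)
    have e1 : ((n + 2 : ℕ) : ℝ) * (Real.pi / m) =
        (n + 1 : ℕ) * (Real.pi / m) + Real.pi / m := by push_cast; ring
    have e2 : (n : ℝ) * (Real.pi / m) = (n + 1 : ℕ) * (Real.pi / m) - Real.pi / m := by
      push_cast; ring
    rw [e1, e2, Real.sin_add, Real.sin_sub]
    field_simp
    ring

theorem dihedralCoeff_nonneg {m n : ℕ} (hm : m ≠ 1) (h : m ≠ 0 → n ≤ m) :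
    0 ≤ dihedralCoeff m n := by
  unfold dihedralCoeff
  split_ifs with h0
  · positivity
  · have := sin_pi_div_pos (m := m) (by omega)
    refine div_nonneg (Real.sin_nonneg_of_nonneg_of_le_pi (by positivity) ?_) this.le
    have hm' : (0 : ℝ) < m := by positivity
    have : (n : ℝ) ≤ m := by exact_mod_cast h h0
    rw [mul_div_assoc', div_le_iff₀ hm']
    nlinarith [Real.pi_pos]

variable [Fintype B] [DecidableEq B]

theorem geometricRep_simple_apply (i : B) (v : B → ℝ) :
    cs.geometricRep (cs.simple i) v = v - (2 * M.cosMatrix.mulVec v i) • Pi.single i 1 := by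
  rw [geometricRep, lift_apply_simple, CoxeterMatrix.simpleReflection, Module.reflection_apply,
      CoxeterMatrix.simpleCoroot_apply]

theorem geometricRep_simple_apply_of_ne {i k : B} (h : k ≠ i) (v : B → ℝ) :
    cs.geometricRep (cs.simple i) v k = v k := by
  simp [geometricRep_simple_apply, h]

theorem geometricRep_simple_single (i j : B) :
    cs.geometricRep (cs.simple i) (Pi.single j 1) =
      Pi.single j 1 - (2 * M.cosMatrix i j) • Pi.single i 1 := by
  simp [geometricRep_simple_apply]

theorem geometricRep_simple_single_self (i : B) :
    cs.geometricRep (cs.simple i) (Pi.single i 1) = - Pi.single i 1 := by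
  rw [geometricRep_simple_single, CoxeterMatrix.cosMatrix_self]
  module

theorem geometricRep_alternatingWord {i j : B} (hij : i ≠ j) (n : ℕ) :
    cs.geometricRep (cs.wordProd (alternatingWord i j n)) (Pi.single i 1) =
      if Even n then
        dihedralCoeff (M i j) (n + 1) • Pi.single i 1 + dihedralCoeff (M i j) n • Pi.single j 1
      else
        dihedralCoeff (M i j) n • Pi.single i 1 +
          dihedralCoeff (M i j) (n + 1) • Pi.single j 1 := by
  have hm := M.off_diagonal i j hij
  induction n with
  | zero => simp [alternatingWord, dihedralCoeff_zero, dihedralCoeff_one hm]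
  | succ n ih =>
    rw [alternatingWord_succ', wordProd_cons, map_mul, LinearEquiv.mul_apply, ih]
    have hc : M.cosMatrix i j = - Real.cos (Real.pi / (M i j : ℝ)) := rfl
    by_cases hn : Even n
    · have hn' : ¬ Even (n + 1) := by simpa [Nat.even_add_one] using hn
      simp only [hn, hn', if_true, if_false, map_add, map_smul, geometricRep_simple_single,
        M.cosMatrix_symm j i, M.cosMatrix_self]
      rw [dihedralCoeff_add_two hm, hc]
      module
    · have hn' : Even (n + 1) := by simpa [Nat.even_add_one] using hn
      simp only [hn, hn', if_true, if_false, map_add, map_smul, geometricRep_simple_single,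
        M.cosMatrix_self]
      rw [dihedralCoeff_add_two hm, hc]
      module

/-- Write `w = v d`, where `d` is an alternating word in `i`, `j` and `v` is shorter with neither
index as right descent. Then `d` sends `α_i` to a nonnegative combination of `α_i` and `α_j`, to
which induction applies. -/
theorem geometricRep_single_nonneg {w : W} {i : B} (hi : ¬ cs.IsRightDescent w i) :
    0 ≤ cs.geometricRep w (Pi.single i 1) := by
  induction h : cs.length w using Nat.strong_induction_on generalizing w i with
  | _ k ih =>
  by_cases hw : w = 1
  · subst hw; simp
  obtain ⟨j, hj⟩ := cs.exists_rightDescent_of_ne_one hw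
  have hij : i ≠ j := by rintro rfl; exact hi hj
  obtain ⟨v, n, h1, h2, h3, h4⟩ := cs.exists_eq_mul_alternatingWord w i j hi
  have hn : n ≠ 0 := by
    rintro rfl
    rw [show w = v by simpa [alternatingWord] using h1] at hj
    exact h4 hj
  have hm := M.off_diagonal i j hij
  -- Since `i` is no descent, `w s_i` has length `|v| + n + 1`; hence the alternating word of length
  -- `n + 1` is reduced and cannot exceed the order `M i j`.
  have hle : M i j ≠ 0 → n + 1 ≤ M i j := by
    intro h0
    by_contra hlt
    refine cs.not_isReduced_alternatingWord j i (m := n + 1) (by rwa [M.symmetric])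
      (by rw [M.symmetric]; omega) ?_
    have hup := cs.not_isRightDescent_iff.mp hi
    have hle := cs.length_wordProd_le (alternatingWord j i (n + 1))
    rw [length_alternatingWord] at hle
    rw [IsReduced, length_alternatingWord]
    have e : w * cs.simple i = v * cs.wordProd (alternatingWord j i (n + 1)) := by
      rw [alternatingWord_succ, wordProd_concat, ← mul_assoc, ← h1]
    have := cs.length_mul_le v (cs.wordProd (alternatingWord j i (n + 1)))
    rw [← e] at this
    omega
  have hv1 := ih _ (by omega) h3 rfl
  have hv2 := ih _ (by omega) h4 rfl
  have hp1 : 0 ≤ dihedralCoeff (M i j) n := dihedralCoeff_nonneg hm fun h => by have := hle h; omega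
  have hp2 : 0 ≤ dihedralCoeff (M i j) (n + 1) := dihedralCoeff_nonneg hm hle
  rw [h1, map_mul, LinearEquiv.mul_apply, geometricRep_alternatingWord cs hij]
  split_ifs <;> rw [map_add, map_smul, map_smul] <;>
    exact add_nonneg (smul_nonneg ‹_› ‹_›) (smul_nonneg ‹_› ‹_›)

theorem geometricRep_single_nonpos {w : W} {i : B} (hi : cs.IsRightDescent w i) :
    cs.geometricRep w (Pi.single i 1) ≤ 0 := by
  have h := cs.geometricRep_single_nonneg (cs.isRightDescent_iff_not_isRightDescent_mul.mp hi)
  rwa [map_mul, LinearEquiv.mul_apply, geometricRep_simple_single_self, map_neg,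
    Left.nonneg_neg_iff] at h

theorem geometricRep_single_ne_zero (w : W) (i : B) :
    cs.geometricRep w (Pi.single i 1) ≠ 0 := by
  simp

theorem isRightDescent_iff_nonpos {w : W} {i : B} :
    cs.IsRightDescent w i ↔ cs.geometricRep w (Pi.single i 1) ≤ 0 := by
  refine ⟨cs.geometricRep_single_nonpos, fun h => ?_⟩
  by_contra h'
  exact cs.geometricRep_single_ne_zero w i (le_antisymm h (cs.geometricRep_single_nonneg h'))

theorem not_isRightDescent_iff_nonneg {w : W} {i : B} :
    ¬ cs.IsRightDescent w i ↔ 0 ≤ cs.geometricRep w (Pi.single i 1) := by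
  refine ⟨cs.geometricRep_single_nonneg, fun h h' => ?_⟩
  exact cs.geometricRep_single_ne_zero w i (le_antisymm (cs.geometricRep_single_nonpos h') h)

theorem isLeftDescent_iff_nonpos {w : W} {i : B} :
    cs.IsLeftDescent w i ↔ cs.geometricRep w⁻¹ (Pi.single i 1) ≤ 0 := by
  rw [← isRightDescent_iff_nonpos, isRightDescent_inv_iff]

theorem not_isLeftDescent_iff_nonneg {w : W} {i : B} :
    ¬ cs.IsLeftDescent w i ↔ 0 ≤ cs.geometricRep w⁻¹ (Pi.single i 1) := by
  rw [← not_isRightDescent_iff_nonneg, isRightDescent_inv_iff]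

theorem geometricRep_single_nonneg_or_nonpos (w : W) (i : B) :
    0 ≤ cs.geometricRep w (Pi.single i 1) ∨ cs.geometricRep w (Pi.single i 1) ≤ 0 := by
  by_cases h : cs.IsRightDescent w i
  · exact Or.inr (cs.geometricRep_single_nonpos h)
  · exact Or.inl (cs.geometricRep_single_nonneg h)

theorem geometricRep_injective : Function.Injective cs.geometricRep := by
  rw [injective_iff_map_eq_one]
  intro w hw
  by_contra h
  obtain ⟨i, hi⟩ := cs.exists_rightDescent_of_ne_one h
  have h1 := cs.geometricRep_single_nonpos hi i
  rw [hw] at h1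
  simp at h1
  linarith

/-- The canonical form. -/
noncomputable def _root_.CoxeterMatrix.form (M : CoxeterMatrix B) (v w : B → ℝ) : ℝ :=
  v ⬝ᵥ M.cosMatrix.mulVec w

end CoxeterSystem

/-! ### Bilinearity of the canonical form -/

namespace CoxeterMatrix

variable {B : Type*} [Fintype B] (M : CoxeterMatrix B)

theorem form_comm (v w : B → ℝ) : M.form v w = M.form w v := by
  have h : M.cosMatrix.transpose = M.cosMatrix := by
    ext i j; exact M.cosMatrix_symm j i
  rw [form, Matrix.dotProduct_mulVec, ← Matrix.mulVec_transpose, h, dotProduct_comm, form]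

theorem form_sub_right (v w w' : B → ℝ) : M.form v (w - w') = M.form v w - M.form v w' := by
  simp [form, Matrix.mulVec_sub]

theorem form_smul_right (c : ℝ) (v w : B → ℝ) : M.form v (c • w) = c * M.form v w := by
  simp [form, Matrix.mulVec_smul]

theorem form_neg_right (v w : B → ℝ) : M.form v (-w) = - M.form v w := by
  simp [form, Matrix.mulVec_neg]

theorem form_sub_left (v v' w : B → ℝ) : M.form (v - v') w = M.form v w - M.form v' w := by
  simp [form]

theorem form_smul_left (c : ℝ) (v w : B → ℝ) : M.form (c • v) w = c * M.form v w := by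
  simp [form]

theorem form_neg_left (v w : B → ℝ) : M.form (-v) w = - M.form v w := by
  simp [form]

theorem form_single_left [DecidableEq B] (i : B) (w : B → ℝ) :
    M.form (Pi.single i 1) w = M.cosMatrix.mulVec w i := by
  simp [form]

theorem form_single_single [DecidableEq B] (i j : B) :
    M.form (Pi.single i 1) (Pi.single j 1) = M.cosMatrix i j := by
  simp [form]

end CoxeterMatrix

/-! ### Invariance of the form, exchange, and additivity of lengths -/

namespace CoxeterSystem

variable {B W : Type*} [Group W] {M : CoxeterMatrix B} (cs : CoxeterSystem M W)
variable [Fintype B] [DecidableEq B]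

theorem geometricRep_simple_apply' (i : B) (v : B → ℝ) :
    cs.geometricRep (cs.simple i) v = v - (2 * M.form (Pi.single i 1) v) • Pi.single i 1 := by
  rw [geometricRep_simple_apply, M.form_single_left]

theorem form_geometricRep (w : W) (v v' : B → ℝ) :
    M.form (cs.geometricRep w v) (cs.geometricRep w v') = M.form v v' := by
  induction w using cs.simple_induction generalizing v v' with
  | simple i =>
    simp only [geometricRep_simple_apply', M.form_sub_left, M.form_sub_right, M.form_smul_left,
      M.form_smul_right, M.form_single_single, M.cosMatrix_self, M.form_comm v (Pi.single i 1)]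
    ring
  | one => simp
  | mul w w' h h' => simp only [map_mul, LinearEquiv.mul_apply, h, h']

theorem form_geometricRep_single_self (w : W) (i : B) :
    M.form (cs.geometricRep w (Pi.single i 1)) (cs.geometricRep w (Pi.single i 1)) = 1 := by
  rw [form_geometricRep, M.form_single_single, M.cosMatrix_self]

theorem form_geometricRep_left (w : W) (v v' : B → ℝ) :
    M.form (cs.geometricRep w v) v' = M.form v (cs.geometricRep w⁻¹ v') := by
  rw [← cs.form_geometricRep w⁻¹ (cs.geometricRep w v), ← LinearEquiv.mul_apply, ← map_mul]
  simp

theorem geometricRep_mul_apply (w w' : W) (v : B → ℝ) :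
    cs.geometricRep (w * w') v = cs.geometricRep w (cs.geometricRep w' v) := by
  rw [map_mul, LinearEquiv.mul_apply]

theorem geometricRep_inv_apply_self (w : W) (v : B → ℝ) :
    cs.geometricRep w⁻¹ (cs.geometricRep w v) = v := by
  rw [← geometricRep_mul_apply]; simp

theorem geometricRep_apply_inv_self (w : W) (v : B → ℝ) :
    cs.geometricRep w (cs.geometricRep w⁻¹ v) = v := by
  rw [← geometricRep_mul_apply]; simp

theorem conj_simple_apply (w : W) (i : B) (v : B → ℝ) :
    cs.geometricRep (w * cs.simple i * w⁻¹) v =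
      v - (2 * M.form (cs.geometricRep w (Pi.single i 1)) v) •
        cs.geometricRep w (Pi.single i 1) := by
  rw [geometricRep_mul_apply, geometricRep_mul_apply, geometricRep_simple_apply', map_sub, map_smul,
    geometricRep_apply_inv_self, form_geometricRep_left]

/-- A unit vector with nonnegative coordinates that is concentrated at one index is simple. -/
theorem _root_.CoxeterMatrix.eq_single_of_form_eq_one {v : B → ℝ} {i : B} (hv : 0 ≤ v)
    (h1 : M.form v v = 1) (h : ∀ k, k ≠ i → v k = 0) : v = Pi.single i 1 := by
  have e : v = v i • Pi.single i 1 := by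
    ext k
    by_cases hk : k = i
    · subst hk; simp
    · simp [hk, h k hk]
  rw [e, M.form_smul_left, M.form_smul_right, M.form_single_single, M.cosMatrix_self] at h1
  have : v i = 1 := by
    have := hv i
    simp only [Pi.zero_apply] at this
    nlinarith
  rw [e, this, one_smul]

/-- A simple reflection makes no other positive root than its own negative. -/
theorem eq_single_of_simple_nonpos {v : B → ℝ} {i : B} (hv : 0 ≤ v)
    (h1 : M.form v v = 1) (h : cs.geometricRep (cs.simple i) v ≤ 0) : v = Pi.single i 1 := by
  refine M.eq_single_of_form_eq_one hv h1 fun k hk => ?_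
  have := h k
  rw [geometricRep_simple_apply_of_ne cs hk] at this
  exact le_antisymm this (hv k)

/-- The root `x α_j` is positive and `s_i` makes it negative, so it is `α_i`; conjugating `s_j` by
`x` therefore gives `s_i`. -/
theorem simple_mul_eq_mul_simple {x : W} {i j : B} (h1 : ¬ cs.IsRightDescent x j)
    (h2 : cs.IsRightDescent (cs.simple i * x) j) : cs.simple i * x = x * cs.simple j := by
  have h1 := cs.geometricRep_single_nonneg h1
  have h2 := cs.geometricRep_single_nonpos h2
  rw [geometricRep_mul_apply] at h2
  have h := cs.eq_single_of_simple_nonpos h1 (cs.form_geometricRep_single_self x j) h2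
  suffices x * cs.simple j * x⁻¹ = cs.simple i by rw [← this]; group
  apply cs.geometricRep_injective
  ext1 v
  rw [conj_simple_apply, h, geometricRep_simple_apply']

/-- The roots: the images of the simple IsRoot. -/
def IsRoot (v : B → ℝ) : Prop := ∃ w i, v = cs.geometricRep w (Pi.single i 1)

variable {cs} in
theorem IsRoot.nonneg_or_nonpos {v : B → ℝ} (hv : cs.IsRoot v) : 0 ≤ v ∨ v ≤ 0 := by
  obtain ⟨w, i, rfl⟩ := hv
  exact cs.geometricRep_single_nonneg_or_nonpos w i

variable {cs} in
theorem IsRoot.form_self {v : B → ℝ} (hv : cs.IsRoot v) : M.form v v = 1 := by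
  obtain ⟨w, i, rfl⟩ := hv
  exact cs.form_geometricRep_single_self w i

variable {cs} in
theorem IsRoot.ne_zero {v : B → ℝ} (hv : cs.IsRoot v) : v ≠ 0 := by
  obtain ⟨w, i, rfl⟩ := hv
  exact cs.geometricRep_single_ne_zero w i

variable {cs} in
theorem IsRoot.map {v : B → ℝ} (hv : cs.IsRoot v) (w : W) : cs.IsRoot (cs.geometricRep w v) := by
  obtain ⟨w', i, rfl⟩ := hv
  exact ⟨w * w', i, by rw [geometricRep_mul_apply]⟩

theorem isRoot_single (i : B) : cs.IsRoot (Pi.single i 1) := ⟨1, i, by simp⟩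

/-- Length counts the positive roots made negative, and lengths add when `x` and `y⁻¹` invert no
common positive root. The induction moves a left descent of `y` over to `x`. -/
theorem length_mul_eq_add (x y : W)
    (h : ∀ v, cs.IsRoot v → 0 ≤ v → cs.geometricRep x v ≤ 0 → 0 ≤ cs.geometricRep y⁻¹ v) :
    cs.length (x * y) = cs.length x + cs.length y := by
  induction hk : cs.length y generalizing x y with
  | zero => rw [cs.length_eq_zero_iff.mp hk]; simp
  | succ k ih =>
    obtain ⟨i, hi⟩ := cs.exists_leftDescent_of_ne_one (w := y) (by rintro rfl; simp at hk)
    have hi' := cs.isLeftDescent_iff.mp hi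
    have hyi := cs.isLeftDescent_iff_nonpos.mp hi
    have hxi : ¬ cs.IsRightDescent x i := by
      intro hx
      have := h _ (cs.isRoot_single i) (by simp) (cs.geometricRep_single_nonpos hx)
      exact (cs.isRoot_single i).map y⁻¹ |>.ne_zero (le_antisymm hyi this)
    have hxi' := cs.not_isRightDescent_iff.mp hxi
    have := ih (x * cs.simple i) (cs.simple i * y) ?_ (by omega)
    · rw [mul_assoc, simple_mul_simple_cancel_left] at this
      omega
    · intro v hv h0 hx
      rw [geometricRep_mul_apply] at hx
      rw [mul_inv_rev, inv_simple, geometricRep_mul_apply]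
      -- The reflection `s_i` keeps `v` positive unless `v = α_i`, which has to be treated
      -- separately.
      rcases (hv.map (cs.simple i)).nonneg_or_nonpos with h1 | h1
      · exact h _ (hv.map _) h1 hx
      · rw [cs.eq_single_of_simple_nonpos h0 hv.form_self h1] at hx ⊢
        rw [geometricRep_simple_single_self, map_neg] 
        simpa using hyi

/-- The converse of `length_mul_eq_add`; it extracts the geometric content of the length condition
that defines dominance. -/
theorem nonneg_of_length_mul_eq_add {x y : W}
    (h : cs.length (x * y) = cs.length x + cs.length y) {v : B → ℝ} (hv : cs.IsRoot v)
    (h0 : 0 ≤ v) (hx : cs.geometricRep x v ≤ 0) : 0 ≤ cs.geometricRep y⁻¹ v := by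
  induction hk : cs.length y generalizing x y v with
  | zero => rw [cs.length_eq_zero_iff.mp hk]; simpa
  | succ k ih =>
    obtain ⟨i, hi⟩ := cs.exists_leftDescent_of_ne_one (w := y) (by rintro rfl; simp at hk)
    have hi' := cs.isLeftDescent_iff.mp hi
    have e : x * cs.simple i * (cs.simple i * y) = x * y := by
      rw [mul_assoc, simple_mul_simple_cancel_left]
    have h1 := cs.length_mul_le (x * cs.simple i) (cs.simple i * y)
    have h2 := cs.length_mul_le x (cs.simple i)
    rw [e] at h1
    rw [length_simple] at h2
    have hxi : ¬ cs.IsRightDescent x i := by rw [not_isRightDescent_iff]; omega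
    have hxi := cs.geometricRep_single_nonneg hxi
    have h3 := ih (x := x * cs.simple i) (y := cs.simple i * y) (by rw [e]; omega)
      (hv.map (cs.simple i)) ?_ ?_ (by omega)
    · rwa [← geometricRep_mul_apply, mul_inv_rev, inv_simple, simple_mul_simple_cancel_right] at h3
    · refine (hv.map (cs.simple i)).nonneg_or_nonpos.resolve_right fun h4 => ?_
      rw [cs.eq_single_of_simple_nonpos h0 hv.form_self h4] at hx
      exact cs.geometricRep_single_ne_zero x i (le_antisymm hx hxi)
    · rwa [← geometricRep_mul_apply, simple_mul_simple_cancel_right]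

end CoxeterSystem

/-! ### The Demazure product -/

namespace CoxeterSystem

variable {B W : Type*} [Group W] {M : CoxeterMatrix B} (cs : CoxeterSystem M W)

open Classical in
/-- The longer of the elements `x` and `s i * x`. -/
noncomputable def demazureSimple (i : B) (x : W) : W :=
  if cs.length x < cs.length (cs.simple i * x) then cs.simple i * x else x

/-- The successive application of the operators `demazureSimple` along a word. -/
noncomputable def demazureWord (ω : List B) (x : W) : W := ω.foldr cs.demazureSimple x

/-- The Demazure product, that is the product of the `0`-Hecke monoid. -/
noncomputable def demazure (w x : W) : W :=
  cs.demazureWord (Classical.choose (cs.exists_isReduced w)) x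

@[simp] theorem demazureWord_nil (x : W) : cs.demazureWord [] x = x := rfl

@[simp] theorem demazureWord_cons (i : B) (ω : List B) (x : W) :
    cs.demazureWord (i :: ω) x = cs.demazureSimple i (cs.demazureWord ω x) := rfl

theorem demazureWord_append (ω ω' : List B) (x : W) :
    cs.demazureWord (ω ++ ω') x = cs.demazureWord ω (cs.demazureWord ω' x) := by
  simp [demazureWord]

theorem demazureSimple_of_isLeftDescent {i : B} {x : W} (h : cs.IsLeftDescent x i) :
    cs.demazureSimple i x = x := if_neg (not_lt_of_gt h)

theorem demazureSimple_of_not_isLeftDescent {i : B} {x : W} (h : ¬ cs.IsLeftDescent x i) :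
    cs.demazureSimple i x = cs.simple i * x := by
  refine if_pos ?_
  have := cs.not_isLeftDescent_iff.mp h
  omega

theorem isLeftDescent_demazureSimple (i : B) (x : W) :
    cs.IsLeftDescent (cs.demazureSimple i x) i := by
  by_cases h : cs.IsLeftDescent x i
  · rwa [demazureSimple_of_isLeftDescent cs h]
  · rw [demazureSimple_of_not_isLeftDescent cs h]
    rw [isLeftDescent_iff_not_isLeftDescent_mul, simple_mul_simple_cancel_left]
    exact h

theorem demazureSimple_simple_mul {i : B} {x : W} (h : cs.IsLeftDescent x i) :
    cs.demazureSimple i (cs.simple i * x) = x := by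
  rw [demazureSimple_of_not_isLeftDescent cs (cs.isLeftDescent_iff_not_isLeftDescent_mul.mp h),
    simple_mul_simple_cancel_left]

theorem demazureWord_eq_mul (ω : List B) (y : W)
    (h : cs.length (cs.wordProd ω * y) = ω.length + cs.length y) :
    cs.demazureWord ω y = cs.wordProd ω * y := by
  induction ω with
  | nil => simp
  | cons i ω ih =>
    have h1 := cs.length_mul_le (cs.simple i) (cs.wordProd ω * y)
    have h2 := cs.length_mul_le (cs.wordProd ω) y
    have h3 := cs.length_wordProd_le ω
    rw [wordProd_cons, mul_assoc, List.length_cons] at h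
    rw [length_simple] at h1
    rw [demazureWord_cons, ih (by omega), demazureSimple_of_not_isLeftDescent, wordProd_cons,
      mul_assoc]
    rw [not_isLeftDescent_iff]
    omega

theorem demazure_eq_mul {x y : W} (h : cs.length (x * y) = cs.length x + cs.length y) :
    cs.demazure x y = x * y := by
  obtain ⟨h1, h2⟩ := Classical.choose_spec (cs.exists_isReduced x)
  unfold demazure
  generalize Classical.choose (cs.exists_isReduced x) = ω at *
  subst h2
  rw [demazureWord_eq_mul]
  rw [h, h1.eq]

theorem demazure_one (x : W) : cs.demazure x 1 = x := by
  rw [demazure_eq_mul] <;> simp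

theorem one_demazure (x : W) : cs.demazure 1 x = x := by
  rw [demazure_eq_mul] <;> simp

/-- Induction along reduced expressions. -/
theorem demazureSimple_induction {p : W → Prop} (x : W) (one : p 1)
    (step : ∀ i x, cs.length x < cs.length (cs.simple i * x) → p x →
      p (cs.demazureSimple i x)) : p x := by
  induction h : cs.length x using Nat.strong_induction_on generalizing x with
  | _ k ih =>
  by_cases hx : x = 1
  · rwa [hx]
  obtain ⟨i, hi⟩ := cs.exists_leftDescent_of_ne_one hx
  rw [← cs.demazureSimple_simple_mul hi]
  exact step i _ (by rwa [simple_mul_simple_cancel_left]) (ih _ (h ▸ hi) _ rfl)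

variable [Fintype B] [DecidableEq B]

/-- Left and right Demazure multiplications commute; the right one is written through inversion. The
delicate case is that neither `i` nor `j` is a descent of `x` but `j` is one of `s_i x`: then `s_i x
= x s_j`, and both sides equal it. -/
theorem demazureSimple_comm (i j : B) (x : W) :
    cs.demazureSimple i (cs.demazureSimple j x⁻¹)⁻¹ =
      (cs.demazureSimple j (cs.demazureSimple i x)⁻¹)⁻¹ := by
  have e : ∀ y : W, ¬ cs.IsRightDescent y j →
      (cs.demazureSimple j y⁻¹)⁻¹ = y * cs.simple j := fun y hy => by
    rw [← isLeftDescent_inv_iff] at hy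
    rw [demazureSimple_of_not_isLeftDescent cs hy]; simp
  have e' : ∀ y : W, cs.IsRightDescent y j → (cs.demazureSimple j y⁻¹)⁻¹ = y := fun y hy => by
    rw [← isLeftDescent_inv_iff] at hy
    rw [demazureSimple_of_isLeftDescent cs hy]; simp
  by_cases h1 : cs.IsLeftDescent x i <;> by_cases h2 : cs.IsRightDescent x j
  · rw [e' x h2, demazureSimple_of_isLeftDescent cs h1, e' x h2]
  · rw [e x h2, demazureSimple_of_isLeftDescent cs h1, e x h2, demazureSimple_of_isLeftDescent]
    have h3 := cs.length_mul_le (cs.simple i * x) (cs.simple j)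
    rw [length_simple] at h3
    rw [isLeftDescent_iff] at h1
    rw [not_isRightDescent_iff] at h2
    rw [IsLeftDescent, ← mul_assoc]
    omega
  · rw [e' x h2, demazureSimple_of_not_isLeftDescent cs h1, e']
    have h3 := cs.length_mul_le (cs.simple i) (x * cs.simple j)
    rw [length_simple] at h3
    rw [not_isLeftDescent_iff] at h1
    rw [isRightDescent_iff] at h2
    rw [IsRightDescent, mul_assoc]
    omega
  · rw [e x h2, demazureSimple_of_not_isLeftDescent cs h1]
    by_cases h3 : cs.IsRightDescent (cs.simple i * x) j
    · rw [e' _ h3, ← cs.simple_mul_eq_mul_simple h2 h3, demazureSimple_of_isLeftDescent]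
      rw [isLeftDescent_iff_not_isLeftDescent_mul, simple_mul_simple_cancel_left]
      exact h1
    · rw [e _ h3, demazureSimple_of_not_isLeftDescent, mul_assoc]
      rw [not_isRightDescent_iff] at h2 h3
      rw [not_isLeftDescent_iff] at h1 ⊢
      rw [← mul_assoc]
      omega

theorem demazureWord_comm (ω : List B) (j : B) (x : W) :
    cs.demazureWord ω (cs.demazureSimple j x⁻¹)⁻¹ =
      (cs.demazureSimple j (cs.demazureWord ω x)⁻¹)⁻¹ := by
  induction ω with
  | nil => rfl
  | cons i ω ih => rw [demazureWord_cons, ih, demazureSimple_comm, demazureWord_cons]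

/-- Left operators commute with the right ones, and the right ones reach every element from `1`, so
a left operator is determined by its value at `1`. Independence of the reduced word and
associativity both come from this. -/
theorem demazureWord_congr {ω ω' : List B} (h : cs.demazureWord ω 1 = cs.demazureWord ω' 1)
    (x : W) : cs.demazureWord ω x = cs.demazureWord ω' x := by
  suffices ∀ y : W, cs.demazureWord ω y⁻¹ = cs.demazureWord ω' y⁻¹ by
    simpa using this x⁻¹
  intro y
  induction y using cs.demazureSimple_induction with
  | one => simpa
  | step i y _ ih =>
    have h1 := cs.demazureWord_comm ω i y⁻¹
    have h2 := cs.demazureWord_comm ω' i y⁻¹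
    rw [inv_inv] at h1 h2
    rw [h1, h2, ih]

theorem demazureWord_eq_demazure (ω : List B) (x : W) :
    cs.demazureWord ω x = cs.demazure (cs.demazureWord ω 1) x :=
  cs.demazureWord_congr (cs.demazure_one _).symm x

theorem demazure_simple (i : B) (x : W) :
    cs.demazure (cs.simple i) x = cs.demazureSimple i x := by
  have h : cs.demazureSimple i 1 = cs.simple i := by
    rw [demazureSimple_of_not_isLeftDescent cs (cs.not_isLeftDescent_one i), mul_one]
  have := cs.demazureWord_eq_demazure [i] x
  simp only [demazureWord_cons, demazureWord_nil, h] at this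
  exact this.symm

theorem demazure_assoc (a b c : W) :
    cs.demazure (cs.demazure a b) c = cs.demazure a (cs.demazure b c) := by
  have h := cs.demazureWord_eq_demazure (Classical.choose (cs.exists_isReduced a) ++
    Classical.choose (cs.exists_isReduced b)) c
  rw [demazureWord_append, demazureWord_append] at h
  have hb : cs.demazureWord (Classical.choose (cs.exists_isReduced b)) 1 = b := cs.demazure_one b
  rw [hb] at h
  exact h.symm

theorem demazure_inv (a b : W) : (cs.demazure a b)⁻¹ = cs.demazure b⁻¹ a⁻¹ := by
  suffices ∀ y : W, (cs.demazure a y⁻¹)⁻¹ = cs.demazure y a⁻¹ by simpa using this b⁻¹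
  intro y
  induction y using cs.demazureSimple_induction with
  | one => rw [inv_one, demazure_one, one_demazure]
  | step i y _ ih =>
    have h1 := cs.demazureWord_comm (Classical.choose (cs.exists_isReduced a)) i y⁻¹
    rw [inv_inv] at h1
    rw [demazure, h1, inv_inv, ← demazure_simple cs i y, demazure_assoc, ← ih, demazure_simple,
      demazure]

/-! ### Twisted involutions, and `π` as a twisted Demazure square -/

namespace DiagramInvolution

variable {cs} (σ : cs.DiagramInvolution)

omit [Fintype B] [DecidableEq B] in
theorem length_apply_le (w : W) : cs.length (σ.toMulEquiv w) ≤ cs.length w := by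
  obtain ⟨ω, hω, rfl⟩ := cs.exists_isReduced w
  rw [hω.eq]
  clear hω
  induction ω with
  | nil => simp
  | cons i ω ih =>
    obtain ⟨j, hj⟩ := σ.map_simple i
    rw [wordProd_cons, map_mul, hj, List.length_cons]
    have := cs.length_mul_le (cs.simple j) (σ.toMulEquiv (cs.wordProd ω))
    rw [length_simple] at this
    omega

omit [Fintype B] [DecidableEq B] in
theorem length_apply (w : W) : cs.length (σ.toMulEquiv w) = cs.length w := by
  refine le_antisymm (σ.length_apply_le w) ?_
  have := σ.length_apply_le (σ.toMulEquiv w)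
  rwa [σ.involutive] at this

theorem map_demazure (a b : W) :
    σ.toMulEquiv (cs.demazure a b) = cs.demazure (σ.toMulEquiv a) (σ.toMulEquiv b) := by
  have key : ∀ i x, σ.toMulEquiv (cs.demazureSimple i x) =
      cs.demazure (σ.toMulEquiv (cs.simple i)) (σ.toMulEquiv x) := by
    intro i x
    obtain ⟨j, hj⟩ := σ.map_simple i
    rw [hj, demazure_simple, demazureSimple, demazureSimple, ← hj, ← map_mul, length_apply,
      length_apply]
    split_ifs <;> rfl
  induction a using cs.demazureSimple_induction with
  | one => rw [map_one, one_demazure, one_demazure]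
  | step i a _ ih =>
    rw [key, demazure_assoc, ← ih, ← demazure_simple, demazure_assoc, demazure_simple, key]

-- Inversion followed by the automorphism preserves length and carries `s x` to `x s^*`.
omit [Fintype B] [DecidableEq B] in
theorem length_mul_apply_simple {x : W} (hx : x ∈ σ.twistedInvolutions) (i : B) :
    cs.length (x * σ.toMulEquiv (cs.simple i)) = cs.length (cs.simple i * x) := by
  have hx' : σ.toMulEquiv x = x⁻¹ := hx
  rw [← length_inv, ← σ.length_apply (cs.simple i * x), map_mul, hx', mul_inv_rev, ← map_inv,
    inv_simple]

/-- The twisted involution obtained from `x` by twisted Demazure conjugation with `s i`. -/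
noncomputable def act (i : B) (x : W) : W :=
  cs.demazure (cs.simple i) (cs.demazure x (σ.toMulEquiv (cs.simple i)))

omit [Fintype B] [DecidableEq B] in
theorem isRightDescent_iff_of_mem {x : W} (hx : x ∈ σ.twistedInvolutions) {i j : B}
    (hj : σ.toMulEquiv (cs.simple i) = cs.simple j) :
    cs.IsRightDescent x j ↔ cs.IsLeftDescent x i := by
  rw [IsRightDescent, IsLeftDescent, ← hj, σ.length_mul_apply_simple hx]

omit [Fintype B] [DecidableEq B] in
theorem demazure_apply_simple {x : W} {i j : B} (hj : σ.toMulEquiv (cs.simple i) = cs.simple j)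
    (h : ¬ cs.IsRightDescent x j) :
    cs.demazure x (σ.toMulEquiv (cs.simple i)) = x * cs.simple j := by
  rw [hj, demazure_eq_mul]
  rw [length_simple]
  exact cs.not_isRightDescent_iff.mp h

theorem demazure_simple_of_isRightDescent {x : W} {j : B} (h : cs.IsRightDescent x j) :
    cs.demazure x (cs.simple j) = x := by
  rw [← inv_inj, demazure_inv, inv_simple, demazure_simple, demazureSimple_of_isLeftDescent]
  exact cs.isLeftDescent_inv_iff.mpr h

theorem act_of_isLeftDescent {x : W} (hx : x ∈ σ.twistedInvolutions) {i : B}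
    (h : cs.IsLeftDescent x i) : σ.act i x = x := by
  obtain ⟨j, hj⟩ := σ.map_simple i
  rw [act, hj, demazure_simple_of_isRightDescent ((σ.isRightDescent_iff_of_mem hx hj).mpr h),
    demazure_simple, demazureSimple_of_isLeftDescent cs h]

theorem act_of_eq {x : W} {i : B} (h : ¬ cs.IsLeftDescent x i)
    (he : cs.simple i * x = x * σ.toMulEquiv (cs.simple i)) : σ.act i x = cs.simple i * x := by
  obtain ⟨j, hj⟩ := σ.map_simple i
  have h1 : ¬ cs.IsRightDescent x j := by rw [IsRightDescent, ← hj, ← he]; exact h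
  rw [act, demazure_apply_simple σ hj h1, demazure_simple, ← hj, ← he,
    demazureSimple_of_isLeftDescent]
  rw [isLeftDescent_iff_not_isLeftDescent_mul, simple_mul_simple_cancel_left]
  exact h

theorem act_of_ne {x : W} (hx : x ∈ σ.twistedInvolutions) {i : B} (h : ¬ cs.IsLeftDescent x i)
    (hne : cs.simple i * x ≠ x * σ.toMulEquiv (cs.simple i)) :
    σ.act i x = cs.simple i * x * σ.toMulEquiv (cs.simple i) := by
  obtain ⟨j, hj⟩ := σ.map_simple i
  have h1 := (σ.isRightDescent_iff_of_mem hx hj).not.mpr h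
  rw [act, demazure_apply_simple σ hj h1, demazure_simple, hj, mul_assoc,
    demazureSimple_of_not_isLeftDescent]
  have h2 : ¬ cs.IsRightDescent (cs.simple i * x) j := fun h2 =>
    hne (by rw [hj]; exact cs.simple_mul_eq_mul_simple h1 h2)
  rw [not_isRightDescent_iff] at h1 h2
  rw [not_isLeftDescent_iff] at h ⊢
  rw [← mul_assoc]
  omega

/-- The three cases in the definition of `T_s` are the three shapes of `s ∘ x ∘ s^*`; only the sign
is lost. -/
theorem nilHeckeSimple_single (i : B) (x : σ.twistedInvolutions) :
    ∃ y : σ.twistedInvolutions, (y : W) = σ.act i x ∧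
      (σ.nilHeckeSimple i (Finsupp.single x 1) = Finsupp.single y 1 ∨
        σ.nilHeckeSimple i (Finsupp.single x 1) = - Finsupp.single y 1) := by
  simp only [nilHeckeSimple, Finsupp.linearCombination_single, one_smul]
  split_ifs with h1 h2
  · exact ⟨_, (σ.act_of_eq (not_lt_of_gt h1) h2).symm, Or.inl rfl⟩
  · exact ⟨_, (σ.act_of_ne x.2 (not_lt_of_gt h1) h2).symm, Or.inl rfl⟩
  · refine ⟨x, (σ.act_of_isLeftDescent x.2 ?_).symm, Or.inr rfl⟩
    by_contra h
    have := cs.not_isLeftDescent_iff.mp h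
    omega

/-- The twisted Demazure square. -/
noncomputable def demazureSquare (w : W) : W := cs.demazure w (σ.toMulEquiv w)⁻¹

/-- By associativity `s ∘ (w ∘ (w^*)⁻¹) ∘ s^*` regroups as `(s ∘ w) ∘ ((s ∘ w)^*)⁻¹`. -/
theorem act_demazureSquare (i : B) (w : W) :
    σ.act i (σ.demazureSquare w) = σ.demazureSquare (cs.demazureSimple i w) := by
  rw [act, demazureSquare, demazureSquare, ← demazure_simple, map_demazure, demazure_inv,
    demazure_assoc, demazure_assoc, ← map_inv σ.toMulEquiv (cs.simple i), inv_simple]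

theorem prod_nilHeckeSimple_single (ω : List B) :
    ∃ y : σ.twistedInvolutions, (y : W) = σ.demazureSquare (cs.demazureWord ω 1) ∧
      (((ω.map σ.nilHeckeSimple).prod : Module.End ℤ (σ.twistedInvolutions →₀ ℤ))
          (Finsupp.single ⟨1, σ.one_mem⟩ 1) = Finsupp.single y 1 ∨
        ((ω.map σ.nilHeckeSimple).prod : Module.End ℤ (σ.twistedInvolutions →₀ ℤ))
          (Finsupp.single ⟨1, σ.one_mem⟩ 1) = - Finsupp.single y 1) := by
  induction ω with
  | nil => exact ⟨⟨1, σ.one_mem⟩, by simp [demazureSquare, one_demazure], Or.inl (by simp)⟩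
  | cons i ω ih =>
    obtain ⟨x, h1, hx⟩ := ih
    obtain ⟨y, h2, hy⟩ := σ.nilHeckeSimple_single i x
    refine ⟨y, by rw [h2, h1, act_demazureSquare, demazureWord_cons], ?_⟩
    rw [List.map_cons, List.prod_cons, Module.End.mul_apply]
    rcases hx with hx | hx <;> rw [hx]
    · exact hy
    · rw [map_neg]
      rcases hy with hy | hy <;> rw [hy]
      · exact Or.inr rfl
      · exact Or.inl (neg_neg _)

theorem pi_eq_demazureSquare (w : W) : (σ.pi w : W) = σ.demazureSquare w := by
  have h := Classical.choose_spec (σ.exists_nilHecke_one w)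
  obtain ⟨y, h1, h2⟩ := σ.prod_nilHeckeSimple_single (Classical.choose (cs.exists_isReduced w))
  have h3 : cs.demazureWord (Classical.choose (cs.exists_isReduced w)) 1 = w := cs.demazure_one w
  rw [h3] at h1
  rw [← h1]
  change (_ = Finsupp.single (σ.pi w) 1 ∨ _ = - Finsupp.single (σ.pi w) 1) at h
  unfold nilHecke at h
  suffices σ.pi w = y by rw [this]
  -- No basis vector is the negative of another, so the element is determined even though the sign
  -- is not recorded.
  have key : ∀ a b : σ.twistedInvolutions,
      (Finsupp.single a 1 : σ.twistedInvolutions →₀ ℤ) = - Finsupp.single b 1 → False := by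
    intro a b hab
    classical
    have := DFunLike.congr_fun hab a
    rw [Finsupp.neg_apply, Finsupp.single_eq_same, Finsupp.single_apply] at this
    split_ifs at this <;> omega
  rcases h with h | h <;> rcases h2 with h2 | h2 <;> rw [h] at h2
  · exact Finsupp.single_left_injective one_ne_zero h2
  · exact (key _ _ h2).elim
  · exact (key _ _ h2.symm).elim
  · exact Finsupp.single_left_injective one_ne_zero (neg_injective h2)

/-- Induction on length: with `s` a left descent of `x ≠ 1`, either `s x` or `s x s^*` is a shorter
twisted involution whose twisted conjugate by `s` is `x`. -/
theorem exists_demazureSquare_eq {x : W} (hx : x ∈ σ.twistedInvolutions) :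
    ∃ w, σ.demazureSquare w = x := by
  induction h : cs.length x using Nat.strong_induction_on generalizing x with
  | _ k ih =>
  by_cases hx1 : x = 1
  · exact ⟨1, by simp [hx1, demazureSquare, one_demazure]⟩
  obtain ⟨i, hi⟩ := cs.exists_leftDescent_of_ne_one hx1
  obtain ⟨j, hj⟩ := σ.map_simple i
  have hxj := (σ.isRightDescent_iff_of_mem hx hj).mpr hi
  have hi' := cs.isLeftDescent_iff_not_isLeftDescent_mul.mp hi
  suffices ∃ y ∈ σ.twistedInvolutions, cs.length y < k ∧ σ.act i y = x by
    obtain ⟨y, hy, hlt, rfl⟩ := this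
    obtain ⟨w, rfl⟩ := ih _ hlt hy rfl
    exact ⟨_, (σ.act_demazureSquare i w).symm⟩
  by_cases he : cs.simple i * x = x * σ.toMulEquiv (cs.simple i)
  · refine ⟨_, σ.simple_mul_mem i hx he, h ▸ hi, ?_⟩
    rw [act_of_eq σ hi', simple_mul_simple_cancel_left]
    rw [he, mul_assoc, ← map_mul, simple_mul_simple_self, map_one, mul_one, ← he,
      simple_mul_simple_cancel_left]
  · have hmem := σ.simple_mul_mul_mem i hx
    -- Otherwise exchange, applied to `s (s x) = x`, would give `x = s x s^*`, contrary to `he`.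
    have hr : cs.IsRightDescent (cs.simple i * x) j := by
      by_contra hr
      refine he ?_
      have h1 : cs.simple i * (cs.simple i * x) = cs.simple i * x * cs.simple j := by
        refine cs.simple_mul_eq_mul_simple hr ?_
        rwa [simple_mul_simple_cancel_left]
      rw [simple_mul_simple_cancel_left] at h1
      nth_rewrite 2 [h1]
      rw [hj, simple_mul_simple_cancel_right]
    rw [hj] at hmem
    refine ⟨_, hmem, ?_, ?_⟩
    · have h1 : cs.length (cs.simple i * x * cs.simple j) < cs.length (cs.simple i * x) := hr
      have h2 : cs.length (cs.simple i * x) < cs.length x := hi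
      omega
    · rw [act, demazure_apply_simple σ hj (cs.isRightDescent_iff_not_isRightDescent_mul.mp hr),
        simple_mul_simple_cancel_right, demazure_simple, demazureSimple_simple_mul cs hi]

end DiagramInvolution

end CoxeterSystem

/-! ### Parabolic subgroups and their longest elements -/

namespace CoxeterSystem

variable {B W : Type*} [Group W] {M : CoxeterMatrix B} (cs : CoxeterSystem M W) {J : Set B}

theorem simple_mem_parabolic {j : B} (hj : j ∈ J) : cs.simple j ∈ cs.parabolic J :=
  Subgroup.subset_closure ⟨j, hj, rfl⟩

theorem longest_spec (hfin : (cs.parabolic J : Set W).Finite) :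
    cs.longest J ∈ cs.parabolic J ∧
      ∀ v ∈ cs.parabolic J, cs.length v ≤ cs.length (cs.longest J) := by
  refine Classical.epsilon_spec (p := fun w => w ∈ cs.parabolic J ∧
    ∀ v ∈ cs.parabolic J, cs.length v ≤ cs.length w) ?_
  obtain ⟨w, hw, h⟩ := Set.exists_max_image _ cs.length hfin ⟨1, one_mem _⟩
  exact ⟨w, hw, h⟩

theorem longest_mem (hfin : (cs.parabolic J : Set W).Finite) :
    cs.longest J ∈ cs.parabolic J := (cs.longest_spec hfin).1

theorem length_le_length_longest (hfin : (cs.parabolic J : Set W).Finite) {v : W}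
    (hv : v ∈ cs.parabolic J) : cs.length v ≤ cs.length (cs.longest J) :=
  (cs.longest_spec hfin).2 v hv

variable [Fintype B] [DecidableEq B]

theorem parabolic_apply_of_notMem {u : W} (hu : u ∈ cs.parabolic J) {k : B} (hk : k ∉ J)
    (v : B → ℝ) : cs.geometricRep u v k = v k := by
  induction hu using Subgroup.closure_induction generalizing v with
  | mem x hx =>
    obtain ⟨j, hj, rfl⟩ := hx
    exact cs.geometricRep_simple_apply_of_ne (by rintro rfl; exact hk hj) v
  | one => simp
  | mul x y _ _ h1 h2 => rw [geometricRep_mul_apply, h1, h2]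
  | inv x _ h => rw [← h (cs.geometricRep x⁻¹ v), geometricRep_apply_inv_self]

/-- Elements of `W_J` do not change coordinates outside `J`, so for `i ∉ J` the root `u α_i` keeps
the coordinate `1` at `i` and cannot be negative. -/
theorem IsRightDescent.mem_of_mem_parabolic {cs : CoxeterSystem M W} {u : W} {i : B}
    (hi : cs.IsRightDescent u i) (hu : u ∈ cs.parabolic J) : i ∈ J := by
  by_contra h
  have h1 := cs.geometricRep_single_nonpos hi i
  rw [cs.parabolic_apply_of_notMem hu h] at h1
  simp at h1
  linarith

theorem IsLeftDescent.mem_of_mem_parabolic {cs : CoxeterSystem M W} {u : W} {i : B}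
    (hi : cs.IsLeftDescent u i) (hu : u ∈ cs.parabolic J) : i ∈ J :=
  (cs.isRightDescent_inv_iff.mpr hi).mem_of_mem_parabolic (inv_mem hu)

theorem geometricRep_nonpos_of_support {w : W}
    (hw : ∀ j ∈ J, cs.geometricRep w (Pi.single j 1) ≤ 0) {v : B → ℝ} (hv : 0 ≤ v)
    (hJ : ∀ k ∉ J, v k = 0) : cs.geometricRep w v ≤ 0 := by
  have e : v = ∑ j, v j • Pi.single j (1 : ℝ) := by
    ext k; simp [Finset.sum_apply, Pi.single_apply]
  rw [e, map_sum]
  refine Finset.sum_nonpos fun j _ => ?_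
  rw [map_smul]
  by_cases hj : j ∈ J
  · exact smul_nonpos_of_nonneg_of_nonpos (hv j) (hw j hj)
  · rw [hJ j hj, zero_smul]

theorem parabolic_apply_single_of_notMem {u : W} (hu : u ∈ cs.parabolic J) {j k : B} (hj : j ∈ J)
    (hk : k ∉ J) : cs.geometricRep u (Pi.single j 1) k = 0 := by
  rw [cs.parabolic_apply_of_notMem hu hk, Pi.single_eq_of_ne]
  rintro rfl; exact hk hj

theorem eq_one_of_mem_parabolic {u : W} (hu : u ∈ cs.parabolic J)
    (h : ∀ j ∈ J, 0 ≤ cs.geometricRep u (Pi.single j 1)) : u = 1 := by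
  by_contra h1
  obtain ⟨i, hi⟩ := cs.exists_rightDescent_of_ne_one h1
  exact cs.not_isRightDescent_iff_nonneg.mpr (h i (hi.mem_of_mem_parabolic hu)) hi

theorem geometricRep_nonpos_of_length_maximal {u : W} (hu : u ∈ cs.parabolic J)
    (h : ∀ v ∈ cs.parabolic J, cs.length v ≤ cs.length u) {j : B} (hj : j ∈ J) :
    cs.geometricRep u (Pi.single j 1) ≤ 0 := by
  refine cs.geometricRep_single_nonpos ?_
  by_contra h1
  have h2 := cs.not_isRightDescent_iff.mp h1
  have := h _ (mul_mem hu (cs.simple_mem_parabolic hj))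
  omega

section Finite

variable (hfin : (cs.parabolic J : Set W).Finite)
include hfin

theorem longest_apply_nonpos {j : B} (hj : j ∈ J) :
    cs.geometricRep (cs.longest J) (Pi.single j 1) ≤ 0 :=
  cs.geometricRep_nonpos_of_length_maximal (cs.longest_mem hfin)
    (fun _ hv => cs.length_le_length_longest hfin hv) hj

/-- Both `u` and `w_J⁻¹` make the simple roots of `J` negative, so `u w_J⁻¹` keeps them nonnegative,
has no descents and is `1`. -/
theorem eq_longest {u : W} (hu : u ∈ cs.parabolic J)
    (h : ∀ j ∈ J, cs.geometricRep u (Pi.single j 1) ≤ 0) : u = cs.longest J := by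
  have hm := inv_mem (cs.longest_mem hfin)
  rw [← mul_inv_eq_one]
  refine cs.eq_one_of_mem_parabolic (mul_mem hu hm) fun j hj => ?_
  rw [geometricRep_mul_apply, ← Left.neg_nonpos_iff, ← map_neg]
  refine cs.geometricRep_nonpos_of_support h ?_ fun k hk => ?_
  · rw [Left.nonneg_neg_iff]
    refine cs.geometricRep_nonpos_of_length_maximal hm (fun v hv => ?_) hj
    rw [length_inv]
    exact cs.length_le_length_longest hfin hv
  · rw [Pi.neg_apply, cs.parabolic_apply_single_of_notMem hm hj hk, neg_zero]

theorem longest_inv : (cs.longest J)⁻¹ = cs.longest J := by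
  have hm := inv_mem (cs.longest_mem hfin)
  refine cs.eq_longest hfin hm fun j hj => ?_
  refine cs.geometricRep_nonpos_of_length_maximal hm (fun v hv => ?_) hj
  rw [length_inv]
  exact cs.length_le_length_longest hfin hv

theorem longest_mul_self : cs.longest J * cs.longest J = 1 := by
  rw [mul_eq_one_iff_eq_inv, longest_inv cs hfin]

theorem longest_mul_cancel_left (w : W) : cs.longest J * (cs.longest J * w) = w := by
  rw [← mul_assoc, longest_mul_self cs hfin, one_mul]

theorem longest_mul_cancel_right (w : W) : w * cs.longest J * cs.longest J = w := by
  rw [mul_assoc, longest_mul_self cs hfin, mul_one]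

theorem longest_apply_apply (v : B → ℝ) :
    cs.geometricRep (cs.longest J) (cs.geometricRep (cs.longest J) v) = v := by
  rw [← geometricRep_mul_apply, longest_mul_self cs hfin]; simp

theorem support_of_longest_apply_nonpos {v : B → ℝ} (hv : 0 ≤ v)
    (h : cs.geometricRep (cs.longest J) v ≤ 0) {k : B} (hk : k ∉ J) : v k = 0 := by
  have := h k
  rw [cs.parabolic_apply_of_notMem (cs.longest_mem hfin) hk] at this
  exact le_antisymm this (hv k)

/-- The opposition involution: `-w_J` permutes the simple roots of `J`. -/
theorem exists_longest_apply_single {j : B} (hj : j ∈ J) :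
    ∃ k ∈ J, cs.geometricRep (cs.longest J) (Pi.single j 1) = - Pi.single k 1 := by
  have hm := cs.longest_mem hfin
  set a : B → ℝ := - cs.geometricRep (cs.longest J) (Pi.single j 1) with ha
  have ha0 : 0 ≤ a := Left.nonneg_neg_iff.mpr (cs.longest_apply_nonpos hfin hj)
  have haJ : ∀ k ∉ J, a k = 0 := fun k hk => by
    rw [ha, Pi.neg_apply, cs.parabolic_apply_single_of_notMem hm hj hk, neg_zero]
  -- Here `α_j` is a sum of nonnegative vectors. Any term with `a k ≠ 0` must then be concentrated
  -- at `j`, and a unit vector of this kind is `α_j` itself.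
  have hsum : Pi.single j 1 = ∑ k, a k • - cs.geometricRep (cs.longest J) (Pi.single k 1) := by
    have e : a = ∑ k, a k • Pi.single k (1 : ℝ) := by
      ext k; simp [Finset.sum_apply, Pi.single_apply]
    have h1 : cs.geometricRep (cs.longest J) a = - Pi.single j 1 := by
      rw [ha, map_neg, longest_apply_apply cs hfin]
    rw [e, map_sum] at h1
    simp only [smul_neg, Finset.sum_neg_distrib, ← map_smul]
    rw [h1, neg_neg]
  have hterm : ∀ k i, 0 ≤ (a k • - cs.geometricRep (cs.longest J) (Pi.single k 1)) i := by
    intro k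
    by_cases hk : k ∈ J
    · exact smul_nonneg (ha0 k) (Left.nonneg_neg_iff.mpr (cs.longest_apply_nonpos hfin hk))
    · rw [haJ k hk, zero_smul]; exact fun _ => le_rfl
  obtain ⟨k, hk⟩ : ∃ k, a k ≠ 0 := by
    by_contra! h
    simp only [h, zero_smul, Finset.sum_const_zero, Pi.single_eq_zero_iff, one_ne_zero] at hsum
  have hkJ : k ∈ J := by by_contra h; exact hk (haJ k h)
  refine ⟨k, hkJ, ?_⟩
  have hkey : - cs.geometricRep (cs.longest J) (Pi.single k 1) = Pi.single j 1 := by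
    refine M.eq_single_of_form_eq_one
      (Left.nonneg_neg_iff.mpr (cs.longest_apply_nonpos hfin hkJ)) ?_ fun i hi => ?_
    · rw [M.form_neg_left, M.form_neg_right, neg_neg, form_geometricRep_single_self]
    · have h1 := congrFun hsum i
      rw [Pi.single_eq_of_ne hi, Finset.sum_apply, eq_comm,
        Finset.sum_eq_zero_iff_of_nonneg fun k _ => hterm k i] at h1
      have h2 := h1 k (Finset.mem_univ k)
      rw [Pi.smul_apply, smul_eq_mul, mul_eq_zero] at h2
      exact h2.resolve_left hk
  rw [← hkey, map_neg, longest_apply_apply cs hfin]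

/-- This replaces the length condition by descents. For the converse, a positive root inverted by
`w_J` is supported on `J`; `w_J` makes it a nonpositive combination of roots that `w⁻¹` makes
negative, so `w_J` and `w⁻¹ w_J` have no common inversion. -/
theorem mem_leftMaximal_iff {w : W} :
    w ∈ cs.leftMaximal J ↔ ∀ j ∈ J, cs.IsLeftDescent w j := by
  constructor
  · intro (h : cs.length w = _) j hj
    have h1 : cs.IsLeftDescent (cs.longest J) j := by
      rw [isLeftDescent_iff_nonpos, longest_inv cs hfin]
      exact cs.longest_apply_nonpos hfin hj
    have h2 := cs.length_mul_le (cs.simple j * cs.longest J) (cs.longest J * w)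
    rw [mul_assoc, longest_mul_cancel_left cs hfin] at h2
    rw [IsLeftDescent] at h1 ⊢
    omega
  · intro h
    have hneg : ∀ j ∈ J, cs.geometricRep w⁻¹ (Pi.single j 1) ≤ 0 := fun j hj =>
      cs.isLeftDescent_iff_nonpos.mp (h j hj)
    have := cs.length_mul_eq_add (cs.longest J) (cs.longest J * w) fun v hv h0 h1 => ?_
    · rw [longest_mul_cancel_left cs hfin] at this
      exact this
    · rw [mul_inv_rev, longest_inv cs hfin, geometricRep_mul_apply, ← Left.neg_nonpos_iff, ← map_neg]
      refine cs.geometricRep_nonpos_of_support hneg (Left.nonneg_neg_iff.mpr h1) fun k hk => ?_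
      rw [Pi.neg_apply, cs.parabolic_apply_of_notMem (cs.longest_mem hfin) hk,
        cs.support_of_longest_apply_nonpos hfin h0 h1 hk, neg_zero]

theorem mem_rightMaximal_iff {w : W} :
    w ∈ cs.rightMaximal J ↔ ∀ j ∈ J, cs.IsRightDescent w j := by
  have h := cs.mem_leftMaximal_iff hfin (w := w⁻¹)
  simp only [isLeftDescent_inv_iff] at h
  rw [← h, rightMaximal, leftMaximal, Set.mem_ofPred_eq, Set.mem_ofPred_eq, length_inv,
    ← cs.length_inv (cs.longest J * w⁻¹), mul_inv_rev, inv_inv, longest_inv cs hfin]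

/-- If `(w' w⁻¹)⁻¹` made some `α_j` negative, then `w⁻¹` would make it positive again, and `j` would
be no left descent of `w'`. -/
theorem leftMaximal_unique {w w' : W} (hw : w ∈ cs.leftMaximal J) (hw' : w' ∈ cs.leftMaximal J)
    (h : w' * w⁻¹ ∈ cs.parabolic J) : w = w' := by
  rw [mem_leftMaximal_iff cs hfin] at hw hw'
  suffices (w' * w⁻¹)⁻¹ = 1 by rw [inv_eq_one, mul_inv_eq_one] at this; exact this.symm
  refine cs.eq_one_of_mem_parabolic (inv_mem h) fun j hj => ?_
  by_contra hneg
  have h1 := (cs.geometricRep_single_nonneg_or_nonpos _ _).resolve_left hneg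
  have h2 : 0 ≤ cs.geometricRep w'⁻¹ (Pi.single j 1) := by
    have e : w'⁻¹ = w⁻¹ * (w' * w⁻¹)⁻¹ := by group
    rw [e, geometricRep_mul_apply, ← Left.neg_nonpos_iff, ← map_neg]
    refine cs.geometricRep_nonpos_of_support
      (fun j hj => cs.isLeftDescent_iff_nonpos.mp (hw j hj)) (Left.nonneg_neg_iff.mpr h1)
      fun k hk => ?_
    rw [Pi.neg_apply, cs.parabolic_apply_single_of_notMem (inv_mem h) hj hk, neg_zero]
  exact cs.not_isLeftDescent_iff_nonneg.mpr h2 (hw' j hj)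

theorem exists_mul_mem_leftMaximal (w : W) : ∃ u ∈ cs.parabolic J, u * w ∈ cs.leftMaximal J := by
  obtain ⟨u, hu, h⟩ := Set.exists_max_image (cs.parabolic J : Set W) (fun u => cs.length (u * w))
    hfin ⟨1, one_mem _⟩
  refine ⟨u, hu, (cs.mem_leftMaximal_iff hfin).mpr fun j hj => ?_⟩
  by_contra h1
  have h2 := cs.not_isLeftDescent_iff.mp h1
  have h3 := h _ (mul_mem (cs.simple_mem_parabolic hj) hu)
  rw [← mul_assoc] at h2
  omega

theorem demazure_of_mem_parabolic {u : W} (hu : u ∈ cs.parabolic J) {x : W}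
    (hx : x ∈ cs.leftMaximal J) : cs.demazure u x = x := by
  induction h : cs.length u using Nat.strong_induction_on generalizing u with
  | _ k ih =>
  by_cases hu1 : u = 1
  · rw [hu1, one_demazure]
  obtain ⟨i, hi⟩ := cs.exists_leftDescent_of_ne_one hu1
  have hiJ := hi.mem_of_mem_parabolic hu
  rw [← cs.demazureSimple_simple_mul hi, ← demazure_simple, demazure_assoc,
    ih _ (h ▸ hi) (mul_mem (cs.simple_mem_parabolic hiJ) hu) rfl, demazure_simple,
    demazureSimple_of_isLeftDescent]
  exact (cs.mem_leftMaximal_iff hfin).mp hx i hiJ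

theorem longest_mem_leftMaximal : cs.longest J ∈ cs.leftMaximal J := by
  rw [leftMaximal, Set.mem_ofPred_eq, longest_mul_self cs hfin, length_one, add_zero]

theorem demazure_mem_leftMaximal {w : W} (hw : w ∈ cs.leftMaximal J) (v : W) :
    cs.demazure w v ∈ cs.leftMaximal J := by
  rw [mem_leftMaximal_iff cs hfin]
  intro j hj
  rw [← cs.demazure_of_mem_parabolic hfin (cs.simple_mem_parabolic hj) hw, demazure_assoc,
    demazure_simple]
  exact cs.isLeftDescent_demazureSimple _ _

end Finite

end CoxeterSystem

/-! ### The radical of an affine canonical form -/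

namespace CoxeterMatrix

variable {B : Type*} {M : CoxeterMatrix B}

theorem cosMatrix_nonpos {i j : B} (h : i ≠ j) : M.cosMatrix i j ≤ 0 := by
  have hm := M.off_diagonal i j h
  change -Real.cos (Real.pi / (M i j : ℝ)) ≤ 0
  rw [Left.neg_nonpos_iff]
  rcases Nat.eq_zero_or_pos (M i j) with h0 | h0
  · simp [h0]
  · have h2 : (2 : ℝ) ≤ M i j := by exact_mod_cast (show 2 ≤ M i j by omega)
    apply Real.cos_nonneg_of_neg_pi_div_two_le_of_le
    · have : 0 ≤ Real.pi / (M i j : ℝ) := by positivity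
      linarith [Real.pi_pos]
    · exact div_le_div_of_nonneg_left Real.pi_pos.le (by norm_num) h2

theorem cosMatrix_neg {i j : B} (h : M.graph.Adj i j) : M.cosMatrix i j < 0 := by
  have hm := M.off_diagonal i j h.1
  have hm2 := h.2
  change -Real.cos (Real.pi / (M i j : ℝ)) < 0
  rw [Left.neg_neg_iff]
  rcases Nat.eq_zero_or_pos (M i j) with h0 | h0
  · simp [h0]
  · have h3 : (2 : ℝ) < M i j := by exact_mod_cast (show 2 < M i j by omega)
    apply Real.cos_pos_of_mem_Ioo
    constructor
    · have : 0 ≤ Real.pi / (M i j : ℝ) := by positivity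
      linarith [Real.pi_pos]
    · exact div_lt_div_of_pos_left Real.pi_pos (by norm_num) h3

variable [Fintype B]

theorem form_self_nonneg (hM : M.cosMatrix.PosSemidef) (v : B → ℝ) : 0 ≤ M.form v v := by
  simpa [form] using hM.dotProduct_mulVec_nonneg v

theorem mulVec_eq_zero_of_form_self (hM : M.cosMatrix.PosSemidef) {v : B → ℝ}
    (h : M.form v v = 0) : M.cosMatrix.mulVec v = 0 := by
  rw [← hM.dotProduct_mulVec_zero_iff]
  simpa [form] using h

/-- The off-diagonal entries are nonpositive. This starts a Perron–Frobenius argument for the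
radical. -/
theorem form_abs_le (v : B → ℝ) : M.form |v| |v| ≤ M.form v v := by
  simp only [form, dotProduct, Matrix.mulVec, Finset.mul_sum]
  refine Finset.sum_le_sum fun i _ => Finset.sum_le_sum fun j _ => ?_
  simp only [Pi.abs_apply]
  by_cases h : i = j
  · subst h
    rw [cosMatrix_self, one_mul, one_mul, abs_mul_abs_self]
  · have h1 := M.cosMatrix_nonpos h
    have h2 : v i * v j ≤ |v i| * |v j| := by rw [← abs_mul]; exact le_abs_self _
    nlinarith

variable (hM : M.IsIrreducibleAffine)
include hM

theorem radical_abs {v : B → ℝ} (hv : M.cosMatrix.mulVec v = 0) : M.cosMatrix.mulVec |v| = 0 := by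
  refine mulVec_eq_zero_of_form_self hM.posSemidef
    (le_antisymm ?_ (form_self_nonneg hM.posSemidef _))
  refine (form_abs_le v).trans ?_
  simp [form, hv]

/-- If `v` vanishes at `i`, row `i` of the equation for `|v|` is a vanishing sum of nonpositive
terms, so `v` vanishes at the neighbours of `i`; connectedness spreads this to all indices. -/
theorem radical_eq_zero {v : B → ℝ} (hv : M.cosMatrix.mulVec v = 0) {i : B} (hi : v i = 0) :
    v = 0 := by
  have hstep : ∀ i j, M.graph.Adj i j → v i = 0 → v j = 0 := by
    intro i j hij hi
    have h1 := congrFun (radical_abs hM hv) i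
    rw [Matrix.mulVec, dotProduct, Pi.zero_apply, Finset.sum_eq_zero_iff_of_nonpos] at h1
    · have h2 := h1 j (Finset.mem_univ j)
      simpa [(cosMatrix_neg hij).ne] using h2
    · intro k _
      by_cases hk : i = k
      · subst hk; simp [hi]
      · exact mul_nonpos_of_nonpos_of_nonneg (cosMatrix_nonpos hk) (abs_nonneg _)
  ext j
  obtain ⟨p⟩ := hM.connected.preconnected i j
  clear hv
  induction p with
  | nil => exact hi
  | cons hadj _ ih => exact ih (hstep _ _ hadj hi)

theorem exists_radical (i : B) :
    ∃ δ : B → ℝ, M.cosMatrix.mulVec δ = 0 ∧ (∀ k, 0 < δ k) ∧ δ i = 1 := by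
  obtain ⟨v, hv0, hv⟩ : ∃ v : B → ℝ, v ≠ 0 ∧ M.form v v = 0 := by
    by_contra! h
    refine hM.not_posDef (Matrix.PosDef.of_dotProduct_mulVec_pos hM.posSemidef.isHermitian
      fun v hv => ?_)
    have := (form_self_nonneg hM.posSemidef v).lt_of_ne' (h v hv)
    simpa [form] using this
  have hr := mulVec_eq_zero_of_form_self hM.posSemidef hv
  have hne : ∀ k, v k ≠ 0 := fun k hk => hv0 (radical_eq_zero hM hr hk)
  refine ⟨|v i|⁻¹ • |v|, ?_, fun k => ?_, ?_⟩
  · rw [Matrix.mulVec_smul, radical_abs hM hr, smul_zero]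
  · have h1 := abs_pos.mpr (hne k)
    have h2 := abs_pos.mpr (hne i)
    simp only [Pi.smul_apply, Pi.abs_apply, smul_eq_mul]
    positivity
  · simp [hne i]

theorem radical_eq_smul {v δ : B → ℝ} {i : B} (hv : M.cosMatrix.mulVec v = 0)
    (hδ : M.cosMatrix.mulVec δ = 0) (hi : δ i = 1) : v = v i • δ := by
  rw [← sub_eq_zero]
  refine radical_eq_zero hM (i := i) ?_ (by simp [hi])
  rw [Matrix.mulVec_sub, Matrix.mulVec_smul, hv, hδ, smul_zero, sub_zero]

/-- The form is positive definite on `v i = 0`, as no nonzero radical vector lies there; the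
constant is its minimum on the compact unit sphere of this hyperplane. -/
theorem exists_le_form_self (i : B) :
    ∃ c > 0, ∀ v : B → ℝ, v i = 0 → c * ‖v‖ ^ 2 ≤ M.form v v := by
  have hcont : Continuous fun v : B → ℝ => M.form v v := by
    unfold form; fun_prop
  set K : Set (B → ℝ) := Metric.sphere 0 1 ∩ {v | v i = 0} with hK
  have hKc : IsCompact K := (isCompact_sphere 0 1).inter_right
    (isClosed_eq (continuous_apply i) continuous_const)
  have hscale : ∀ v : B → ℝ, v ≠ 0 → v i = 0 → ‖v‖⁻¹ • v ∈ K := by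
    intro v hv hvi
    refine ⟨?_, by simp [hvi]⟩
    rw [mem_sphere_zero_iff_norm, norm_smul, norm_inv, norm_norm,
      inv_mul_cancel₀ (norm_ne_zero_iff.mpr hv)]
  rcases K.eq_empty_or_nonempty with h | h
  · refine ⟨1, one_pos, fun v hvi => ?_⟩
    have : v = 0 := by
      by_contra hv
      have := hscale v hv hvi
      simp [h] at this
    simp [this, form]
  · obtain ⟨x, hx, hmin⟩ := hKc.exists_isMinOn h hcont.continuousOn
    refine ⟨M.form x x, (form_self_nonneg hM.posSemidef x).lt_of_ne' fun h0 => ?_,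
      fun v hvi => ?_⟩
    · have := radical_eq_zero hM (mulVec_eq_zero_of_form_self hM.posSemidef h0) hx.2
      have h1 := mem_sphere_zero_iff_norm.mp hx.1
      rw [this, norm_zero] at h1
      exact zero_ne_one h1
    · by_cases hv : v = 0
      · simp [hv, form]
      · have h1 := hmin (hscale v hv hvi)
        simp only [Set.mem_ofPred_eq, form_smul_left, form_smul_right] at h1
        have h2 : 0 < ‖v‖ := norm_pos_iff.mpr hv
        calc M.form x x * ‖v‖ ^ 2 ≤ (‖v‖⁻¹ * (‖v‖⁻¹ * M.form v v)) * ‖v‖ ^ 2 := by gcongr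
          _ = M.form v v := by field_simp

end CoxeterMatrix

/-! ### Translations and the stabilizer of a special vertex -/

namespace CoxeterSystem

variable {B W : Type*} [Group W] {M : CoxeterMatrix B} (cs : CoxeterSystem M W) {J : Set B}
variable [Fintype B] [DecidableEq B]

/-- The images of the `α_j`, `j ∈ J`, under `W_J` lie in a hyperplane `v i = 0` on which the form is
definite, so they are bounded. Distinct elements of `W_J` send some `α_j` to points uniformly far
apart, and total boundedness excludes infinitely many of them. -/
theorem parabolic_finite (hM : M.IsIrreducibleAffine) (hJ : J ≠ Set.univ) :
    (cs.parabolic J : Set W).Finite := by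
  classical
  obtain ⟨i, hi⟩ := (Set.ne_univ_iff_exists_notMem J).mp hJ
  obtain ⟨c, hc, hbound⟩ := M.exists_le_form_self hM i
  have hcont : Continuous fun v : B → ℝ => M.form v v := by
    unfold CoxeterMatrix.form; fun_prop
  obtain ⟨ε, hε, hsmall⟩ : ∃ ε > 0, ∀ v : B → ℝ, ‖v‖ < ε → M.form v v < c := by
    have h1 : ∀ᶠ v in nhds (0 : B → ℝ), M.form v v < c :=
      hcont.continuousAt.eventually_lt continuousAt_const (by simpa [CoxeterMatrix.form])
    obtain ⟨ε, hε, h⟩ := Metric.eventually_nhds_iff.mp h1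
    exact ⟨ε, hε, fun v hv => h (by simpa using hv)⟩
  by_contra hinf
  let F : W → B → B → ℝ := fun u j => if j ∈ J then cs.geometricRep u (Pi.single j 1) else 0
  have hF : ∀ u ∈ cs.parabolic J, F u ∈ Metric.closedBall (0 : B → B → ℝ) (1 + c⁻¹) := by
    intro u hu
    have h0 : 0 < c⁻¹ := inv_pos.mpr hc
    rw [mem_closedBall_zero_iff, pi_norm_le_iff_of_nonneg (by positivity)]
    intro j
    by_cases hj : j ∈ J
    · simp only [F, hj, if_true]
      have h1 := hbound _ (cs.parabolic_apply_single_of_notMem hu hj hi)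
      rw [form_geometricRep_single_self] at h1
      have h2 : ‖cs.geometricRep u (Pi.single j 1)‖ ^ 2 ≤ c⁻¹ := by
        rwa [← one_div, le_div_iff₀' hc]
      nlinarith [sq_nonneg (‖cs.geometricRep u (Pi.single j 1)‖ - 1)]
    · simp only [F, hj, if_false, norm_zero]
      positivity
  obtain ⟨s, hs, hcover⟩ := Metric.totallyBounded_iff.mp
    (isCompact_closedBall (0 : B → B → ℝ) (1 + c⁻¹)).totallyBounded (ε / 2) (half_pos hε)
  have hch : ∀ u : W, ∃ y, u ∈ cs.parabolic J → y ∈ s ∧ dist (F u) y < ε / 2 := by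
    intro u
    by_cases hu : u ∈ cs.parabolic J
    · have := hcover (hF u hu)
      simp only [Set.mem_iUnion, Metric.mem_ball, exists_prop] at this
      obtain ⟨y, hy⟩ := this
      exact ⟨y, fun _ => hy⟩
    · exact ⟨0, fun h => absurd h hu⟩
  choose g hg using hch
  obtain ⟨u, hu, v, hv, huv, hguv⟩ := Set.Infinite.exists_ne_map_eq_of_mapsTo (f := g) hinf
    (fun u hu => (hg u hu).1) hs
  have hne : v⁻¹ * u ≠ 1 := fun h => huv (inv_mul_eq_one.mp h).symm
  obtain ⟨j, hj⟩ := cs.exists_rightDescent_of_ne_one hne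
  have hmem : v⁻¹ * u ∈ cs.parabolic J := mul_mem (inv_mem hv) hu
  have hjJ := hj.mem_of_mem_parabolic hmem
  have hneg := cs.geometricRep_single_nonpos hj
  set x := cs.geometricRep (v⁻¹ * u) (Pi.single j 1) - Pi.single j 1 with hx
  have hxv : cs.geometricRep v x =
      cs.geometricRep u (Pi.single j 1) - cs.geometricRep v (Pi.single j 1) := by
    rw [hx, map_sub, ← geometricRep_mul_apply, mul_inv_cancel_left]
  have hxi : x i = 0 := by
    rw [hx, Pi.sub_apply, cs.parabolic_apply_of_notMem hmem hi, sub_self]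
  -- The image of `α_j` is nonpositive, so coordinate `j` of the difference is at most `-1`.
  have hx1 : 1 ≤ ‖x‖ := by
    refine le_trans ?_ (norm_le_pi_norm x j)
    have := hneg j
    rw [hx, Pi.sub_apply, Pi.single_eq_same, Real.norm_eq_abs, abs_of_nonpos]
    all_goals simp only [Pi.zero_apply] at this; linarith
  have hge : c ≤ M.form x x := by
    exact (le_mul_of_one_le_right hc.le (one_le_pow₀ hx1)).trans (hbound x hxi)
  have hlt : M.form x x < c := by
    rw [← cs.form_geometricRep v]
    refine hsmall _ ?_
    have h1 : dist (F u) (F v) < ε := by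
      have h2 := (hg u hu).2
      have h3 := (hg v hv).2
      rw [← hguv] at h3
      have := dist_triangle_right (F u) (F v) (g u)
      linarith
    refine lt_of_le_of_lt ?_ h1
    have h2 := dist_le_pi_dist (F u) (F v) j
    simp only [F, hjJ, if_true] at h2
    rwa [hxv, ← dist_eq_norm]
  exact absurd hge (not_le_of_gt hlt)

section Radical

variable {δ : B → ℝ} {o : B}

/-- If `g` kills `δ`, then `f` and `f + g` both lie in the affine space and are shifted by the same
vector, so `g` is invariant under `t`. Taking `g = x_k - δ_k x_o` for all `k` shows that `t v - v`
is a multiple of `δ`. -/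
theorem translations_apply (hM : M.IsIrreducibleAffine) (hδ : M.cosMatrix.mulVec δ = 0)
    (ho : δ o = 1) {t : W} (ht : t ∈ cs.translations) (v : B → ℝ) :
    cs.geometricRep t v = v + (cs.geometricRep t v o - v o) • δ := by
  obtain ⟨u, hu⟩ := inv_mem ht
  have hrad : ∀ v, M.cosMatrix.mulVec v = 0 → v = v o • δ := fun v hv =>
    M.radical_eq_smul hM hv hδ ho
  let f : Module.Dual ℝ (B → ℝ) := ∑ i, LinearMap.proj i
  have hf : f ∈ M.affineSpace := fun v _ => by simp [f]
  have key : ∀ g : Module.Dual ℝ (B → ℝ), g δ = 0 → g (cs.geometricRep t v) = g v := by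
    intro g hg
    have hfg : f + g ∈ M.affineSpace := fun v hv => by
      rw [LinearMap.add_apply, hf v hv, hrad v hv, map_smul, hg, smul_zero, add_zero]
    have h1 := LinearMap.congr_fun (hu f hf) v
    have h2 := LinearMap.congr_fun (hu _ hfg) v
    simp only [dualAct, inv_inv, LinearMap.comp_apply, LinearMap.add_apply,
      LinearEquiv.coe_coe] at h1 h2
    linarith
  ext k
  have := key (LinearMap.proj k - δ k • LinearMap.proj o) (by simp [ho])
  simp only [LinearMap.sub_apply, LinearMap.smul_apply, LinearMap.proj_apply, smul_eq_mul] at this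
  simp only [Pi.add_apply, Pi.smul_apply, smul_eq_mul]
  linarith

theorem translations_inv_apply (hM : M.IsIrreducibleAffine) (hδ : M.cosMatrix.mulVec δ = 0)
    (ho : δ o = 1) {t : W} (ht : t ∈ cs.translations) (v : B → ℝ) :
    cs.geometricRep t⁻¹ v = v - (cs.geometricRep t v o - v o) • δ := by
  have h := congrArg (cs.geometricRep t⁻¹) (cs.translations_apply hM hδ ho ht v)
  rw [geometricRep_inv_apply_self, map_add, map_smul, cs.geometricRep_radical _ _ hδ] at h
  rw [eq_sub_iff_add_eq]
  exact h.symm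

theorem eq_one_of_mem_parabolic_of_mem_translations (hM : M.IsIrreducibleAffine)
    (hJ : J ≠ Set.univ) {t : W} (h : t ∈ cs.parabolic J) (ht : t ∈ cs.translations) : t = 1 := by
  obtain ⟨o, ho⟩ := (Set.ne_univ_iff_exists_notMem J).mp hJ
  obtain ⟨δ, hδ, -, h1⟩ := M.exists_radical hM o
  apply cs.geometricRep_injective
  ext1 v
  rw [cs.translations_apply hM hδ h1 ht, cs.parabolic_apply_of_notMem h ho]
  simp

/-- With two indices `i`, `k` outside `J` there would be a nonzero `x` fixed by `W_J` with `x i =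
0`. Writing `s_j = u t`, the difference `s_j x - x` is a multiple of both `α_j` and `δ`, hence zero;
so `x` lies in the radical and vanishes at `i`, a contradiction. -/
theorem compl_subsingleton (hM : M.IsIrreducibleAffine)
    (hW : ∀ w : W, ∃ u ∈ cs.parabolic J, ∃ t ∈ cs.translations, w = u * t) {i k : B}
    (hi : i ∉ J) (hk : k ∉ J) : i = k := by
  classical
  by_contra hik
  obtain ⟨δ, hδ, hpos, hδi⟩ := M.exists_radical hM i
  -- Coordinate `k` of `L` is identically zero, so `L` is not surjective; its kernel supplies `x`.
  let L : (B → ℝ) →ₗ[ℝ] (B → ℝ) := LinearMap.pi fun j =>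
    if j ∈ J then LinearMap.proj j ∘ₗ M.cosMatrix.mulVecLin
    else if j = i then LinearMap.proj i else 0
  have hLJ : ∀ v, ∀ j ∈ J, L v j = M.cosMatrix.mulVec v j := fun v j hj => by simp [L, hj]
  have hLi : ∀ v, L v i = v i := fun v => by simp [L, hi]
  have hLk : ∀ v, L v k = 0 := fun v => by simp [L, hk, Ne.symm hik]
  have hns : ¬ Function.Surjective L := fun h => by
    obtain ⟨v, hv⟩ := h (Pi.single k 1)
    have := hLk v
    rw [hv] at this
    simp at this
  rw [← LinearMap.injective_iff_surjective, injective_iff_map_eq_zero] at hns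
  push Not at hns
  obtain ⟨x, hx, hx0⟩ := hns
  refine hx0 (M.radical_eq_zero hM (i := i) ?_ (by rw [← hLi x, hx]; rfl))
  have hfix : ∀ u ∈ cs.parabolic J, cs.geometricRep u x = x := by
    intro u hu
    induction hu using Subgroup.closure_induction with
    | mem w hw =>
      obtain ⟨j, hj, rfl⟩ := hw
      rw [geometricRep_simple_apply, ← hLJ x j hj, hx]
      simp
    | one => simp
    | mul a b _ _ h1 h2 => rw [geometricRep_mul_apply, h2, h1]
    | inv a _ h => nth_rewrite 1 [← h]; rw [geometricRep_inv_apply_self]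
  ext j
  by_cases hj : j ∈ J
  · rw [← hLJ x j hj, hx]
  obtain ⟨u, hu, t, ht, he⟩ := hW (cs.simple j)
  have h1 : cs.geometricRep (cs.simple j) x = x + (cs.geometricRep t x i - x i) • δ := by
    rw [he, geometricRep_mul_apply]
    nth_rewrite 1 [cs.translations_apply hM hδ hδi ht]
    rw [map_add, map_smul, hfix u hu, cs.geometricRep_radical _ _ hδ]
  obtain ⟨l, hl⟩ : ∃ l, l ≠ j := by
    by_cases h : i = j
    · exact ⟨k, fun hkj => hik (h.trans hkj.symm)⟩
    · exact ⟨i, h⟩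
  rw [geometricRep_simple_apply] at h1
  have h2 := congrFun h1 l
  have h3 := congrFun h1 j
  simp only [Pi.sub_apply, Pi.add_apply, Pi.smul_apply, Pi.single_eq_of_ne hl, Pi.single_eq_same,
    smul_eq_mul] at h2 h3
  have h4 : cs.geometricRep t x i - x i = 0 := by
    have := (hpos l).ne'
    have h5 : (cs.geometricRep t x i - x i) * δ l = 0 := by linarith
    exact (mul_eq_zero.mp h5).resolve_right this
  rw [h4] at h3
  simp only [Pi.zero_apply]
  linarith

end Radical

/-- A vector that is dominant for `J` is the only dominant one in its orbit under `W_J`. -/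
theorem geometricRep_eq_of_dominant {u : W} (hu : u ∈ cs.parabolic J) {x : B → ℝ}
    (h1 : ∀ j ∈ J, 0 ≤ M.form (Pi.single j 1) x)
    (h2 : ∀ j ∈ J, 0 ≤ M.form (Pi.single j 1) (cs.geometricRep u x)) :
    cs.geometricRep u x = x := by
  have hdom : ∀ y : B → ℝ, (∀ j ∈ J, 0 ≤ M.form (Pi.single j 1) y) →
      ∀ v : B → ℝ, 0 ≤ v → (∀ k ∉ J, v k = 0) → 0 ≤ M.form v y := by
    intro y hy v hv hvJ
    rw [CoxeterMatrix.form, dotProduct]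
    refine Finset.sum_nonneg fun j _ => ?_
    by_cases hj : j ∈ J
    · rw [← M.form_single_left]
      exact mul_nonneg (hv j) (hy j hj)
    · rw [hvJ j hj, zero_mul]
  induction h : cs.length u using Nat.strong_induction_on generalizing u with
  | _ k ih =>
  by_cases hu1 : u = 1
  · simp [hu1]
  obtain ⟨j, hj⟩ := cs.exists_rightDescent_of_ne_one hu1
  have hjJ := hj.mem_of_mem_parabolic hu
  -- Pairing `-u α_j ≥ 0` with `u x` gives `(α_j, x) ≤ 0`; hence `s_j` fixes `x`, and `u` can be
  -- shortened.
  have h3 := hdom _ h2 (- cs.geometricRep u (Pi.single j 1))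
    (Left.nonneg_neg_iff.mpr (cs.geometricRep_single_nonpos hj)) fun k hk => by
      rw [Pi.neg_apply, cs.parabolic_apply_single_of_notMem hu hjJ hk, neg_zero]
  rw [M.form_neg_left, form_geometricRep] at h3
  have h4 : cs.geometricRep (cs.simple j) x = x := by
    rw [geometricRep_simple_apply', show M.form (Pi.single j 1) x = 0 by linarith [h1 j hjJ]]
    simp
  have h5 : cs.geometricRep (u * cs.simple j) x = cs.geometricRep u x := by
    rw [geometricRep_mul_apply, h4]
  rw [← h5]
  exact ih _ (h ▸ hj) (mul_mem hu (cs.simple_mem_parabolic hjJ)) (by rwa [h5]) rfl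

end CoxeterSystem

/-! ### The opposition automorphism -/

namespace CoxeterSystem

variable {B W : Type*} [Group W] {M : CoxeterMatrix B} (cs : CoxeterSystem M W)

section Intertwiner

variable [Fintype B] [DecidableEq B] {τ : B → B} {E : (B → ℝ) → (B → ℝ)}

/-- An involution of the geometric representation that permutes the simple roots and the simple
reflections comes from an automorphism. -/
theorem exists_diagramInvolution (hE : ∀ v, E (E v) = v)
    (hτ : ∀ i, E (Pi.single i 1) = Pi.single (τ i) 1)
    (hs : ∀ i v, E (cs.geometricRep (cs.simple i) (E v)) = cs.geometricRep (cs.simple (τ i)) v) :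
    ∃ σ : cs.DiagramInvolution, (∀ i, σ.toMulEquiv (cs.simple i) = cs.simple (τ i)) ∧
      ∀ w v, cs.geometricRep (σ.toMulEquiv w) v = E (cs.geometricRep w (E v)) := by
  have hττ : ∀ i, τ (τ i) = i := fun i => by
    have h := hE (Pi.single i 1)
    rw [hτ, hτ] at h
    by_contra hne
    have := congrFun h i
    rw [Pi.single_eq_same, Pi.single_eq_of_ne (Ne.symm hne)] at this
    exact zero_ne_one this
  have hlift : M.IsLiftable fun i => cs.simple (τ i) := by
    intro i j
    apply cs.geometricRep_injective
    ext1 v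
    have key : ∀ n : ℕ, ∀ v, cs.geometricRep ((cs.simple (τ i) * cs.simple (τ j)) ^ n) v =
        E (cs.geometricRep ((cs.simple i * cs.simple j) ^ n) (E v)) := by
      intro n
      induction n with
      | zero => intro v; simp [hE]
      | succ n ih =>
        intro v
        rw [pow_succ, pow_succ, geometricRep_mul_apply, geometricRep_mul_apply,
          geometricRep_mul_apply, geometricRep_mul_apply, ih, ← hs j, ← hs i, hE, hE]
    rw [key, simple_mul_simple_pow]
    simp [hE]
  let e : W →* W := cs.lift ⟨fun i => cs.simple (τ i), hlift⟩
  have hes : ∀ i, e (cs.simple i) = cs.simple (τ i) := fun i => cs.lift_apply_simple hlift i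
  have hee : e.comp e = MonoidHom.id W := cs.ext_simple fun i => by
    rw [MonoidHom.comp_apply, hes, hes, hττ, MonoidHom.id_apply]
  refine ⟨⟨e.toMulEquiv e hee hee, fun w => DFunLike.congr_fun hee w, fun i => ⟨τ i, hes i⟩⟩,
    hes, fun w v => ?_⟩
  change cs.geometricRep (e w) v = _
  induction w using cs.simple_induction generalizing v with
  | simple i => rw [hes, hs]
  | one => simp [hE]
  | mul w w' h h' => rw [map_mul, geometricRep_mul_apply, h', h, hE, geometricRep_mul_apply]

end Intertwiner

variable {J : Set B} [Fintype B] [DecidableEq B]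

theorem isOpposition_unique (hW : ∀ w : W, ∃ u ∈ cs.parabolic J, ∃ t ∈ cs.translations, w = u * t)
    {e e' : W ≃* W} (h : cs.IsOpposition J e) (h' : cs.IsOpposition J e') : e = e' := by
  ext w
  obtain ⟨u, hu, t, ht, rfl⟩ := hW w
  rw [map_mul, map_mul, h.1 u hu, h'.1 u hu, h.2 t ht, h'.2 t ht]

/-- The vector `δ - α_o`, where `δ` spans the radical, is mapped to its negative by the longest
element of the stabilizer of a special vertex. -/
theorem longest_apply_sub_single (hM : M.IsIrreducibleAffine)
    (hfin : (cs.parabolic J : Set W).Finite)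
    (hW : ∀ w : W, ∃ u ∈ cs.parabolic J, ∃ t ∈ cs.translations, w = u * t) {o : B} (ho : o ∉ J)
    {δ : B → ℝ} (hδ : M.cosMatrix.mulVec δ = 0) (hδo : δ o = 1) :
    cs.geometricRep (cs.longest J) (δ - Pi.single o 1) = - (δ - Pi.single o 1) := by
  have hδw := fun w => cs.geometricRep_radical w δ hδ
  set γ := δ - Pi.single o 1 with hγ
  have hγo : γ o = 0 := by simp [hγ, hδo]
  obtain ⟨u, hu, t, ht, he⟩ := hW (cs.simple o)
  have h1 : cs.geometricRep (cs.simple o) γ = (2 : ℝ) • δ - γ := by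
    rw [hγ, map_sub, hδw, geometricRep_simple_single_self]
    module
  -- From `s_o γ = 2δ - γ` and `t γ = γ + c δ` one gets `u γ = (2 - c) δ - γ`; coordinate `o`,
  -- unchanged by `u`, forces `c = 2`.
  have h2 : cs.geometricRep u γ = - γ := by
    rw [he, geometricRep_mul_apply, cs.translations_apply hM hδ hδo ht, map_add, map_smul,
      hδw] at h1
    have h3 := congrFun h1 o
    rw [Pi.add_apply, cs.parabolic_apply_of_notMem hu ho, Pi.smul_apply, Pi.sub_apply,
      Pi.smul_apply, hγo, hδo] at h3
    rw [show cs.geometricRep t γ o - γ o = 2 by rw [hγo]; simpa using h3] at h1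
    exact eq_neg_of_add_eq_zero_left (by linear_combination (exp := 1) h1)
  have hdom : ∀ j ∈ J, 0 ≤ M.form (Pi.single j 1) γ := by
    intro j hj
    rw [hγ, M.form_sub_right, M.form_single_left, hδ, M.form_single_single, Pi.zero_apply,
      zero_sub, Left.nonneg_neg_iff]
    exact M.cosMatrix_nonpos (by rintro rfl; exact ho hj)
  have hm := cs.longest_mem hfin
  -- Both `γ` and `w_J u γ = -w_J γ` are dominant for `J` and lie in one orbit, so they coincide.
  have h4 := cs.geometricRep_eq_of_dominant (mul_mem hm hu) hdom fun j hj => by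
    obtain ⟨k, hk, hjk⟩ := cs.exists_longest_apply_single hfin hj
    rw [geometricRep_mul_apply, h2, M.form_comm, form_geometricRep_left, longest_inv cs hfin, hjk,
      M.form_neg_left, M.form_neg_right, neg_neg, M.form_comm]
    exact hdom k hk
  rw [geometricRep_mul_apply, h2, map_neg] at h4
  rw [← neg_eq_iff_eq_neg, h4]

/-- The automorphism is conjugation by the isometric involution `E`. On the simple roots of `J` it
is `-w_J`, which permutes them; the term `2 v_o δ` makes it fix `α_o`, by
`longest_apply_sub_single`. Modulo `δ` it is `-w_J`, whose sign turns a shift by `c(v) δ` into its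
opposite, whence `t⁻¹`. -/
theorem exists_isOpposition (hM : M.IsIrreducibleAffine) (hJ : J ≠ Set.univ)
    (hW : ∀ w : W, ∃ u ∈ cs.parabolic J, ∃ t ∈ cs.translations, w = u * t) :
    ∃ σ : cs.DiagramInvolution, cs.IsOpposition J σ.toMulEquiv ∧
      σ.toMulEquiv '' (cs.simple '' J) = cs.simple '' J := by
  have hfin := cs.parabolic_finite hM hJ
  obtain ⟨o, ho⟩ := (Set.ne_univ_iff_exists_notMem J).mp hJ
  have hJo : ∀ i, i ≠ o → i ∈ J := fun i hi => by
    by_contra h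
    exact hi (cs.compl_subsingleton hM hW h ho)
  obtain ⟨δ, hδ, -, hδo⟩ := M.exists_radical hM o
  have hδw := fun w => cs.geometricRep_radical w δ hδ
  have hm := cs.longest_mem hfin
  set E : (B → ℝ) → (B → ℝ) := fun v => (2 * v o) • δ - cs.geometricRep (cs.longest J) v with hEdef
  have hEo : ∀ v, E v o = v o := fun v => by
    simp only [hEdef, Pi.sub_apply, Pi.smul_apply, hδo, cs.parabolic_apply_of_notMem hm ho,
      smul_eq_mul]
    ring
  have hE : ∀ v, E (E v) = v := fun v => by
    have : E (E v) = (2 * E v o) • δ - cs.geometricRep (cs.longest J) (E v) := rfl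
    rw [this, hEo, hEdef]
    simp only [map_sub, map_smul, hδw, longest_apply_apply cs hfin]
    module
  have hEo' : E (Pi.single o 1) = Pi.single o 1 := by
    have h := cs.longest_apply_sub_single hM hfin hW ho hδ hδo
    rw [map_sub, hδw, sub_eq_iff_eq_add, ← sub_eq_iff_eq_add'] at h
    simp only [hEdef, Pi.single_eq_same, ← h]
    module
  have hEJ : ∀ j ∈ J, ∃ k ∈ J, E (Pi.single j 1) = Pi.single k 1 := fun j hj => by
    obtain ⟨k, hk, hjk⟩ := cs.exists_longest_apply_single hfin hj
    refine ⟨k, hk, ?_⟩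
    simp only [hEdef, hjk, Pi.single_eq_of_ne (show o ≠ j by rintro rfl; exact ho hj)]
    simp
  have hτ : ∀ i, ∃ k, (i ∈ J → k ∈ J) ∧ E (Pi.single i 1) = Pi.single k 1 := fun i => by
    by_cases hi : i = o
    · subst hi; exact ⟨i, fun h => h, hEo'⟩
    · obtain ⟨k, hk, h⟩ := hEJ i (hJo i hi)
      exact ⟨k, fun _ => hk, h⟩
  choose τ hτJ hτ using hτ
  have hlin : ∀ (c : ℝ) v v', E (v - c • v') = E v - c • E v' := fun c v v' => by
    simp only [hEdef, map_sub, map_smul, Pi.sub_apply, Pi.smul_apply, smul_eq_mul]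
    module
  have hform : ∀ v v', M.form (E v) (E v') = M.form v v' := fun v v' => by
    have hd : ∀ v, M.form v δ = 0 := fun v => by simp [CoxeterMatrix.form, hδ]
    have hd' : ∀ v, M.form δ v = 0 := fun v => by rw [M.form_comm, hd]
    simp only [hEdef, M.form_sub_left, M.form_sub_right, M.form_smul_left, M.form_smul_right, hd,
      hd', form_geometricRep]
    ring
  obtain ⟨σ, hσs, hσ⟩ := cs.exists_diagramInvolution hE hτ fun i v => by
    rw [geometricRep_simple_apply', geometricRep_simple_apply', hlin, hE, hτ,
      ← hform (Pi.single i 1), hE, hτ]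
  refine ⟨σ, ⟨fun u hu => ?_, fun t ht => ?_⟩, ?_⟩
  · apply cs.geometricRep_injective
    ext1 v
    rw [hσ, geometricRep_mul_apply, geometricRep_mul_apply]
    have h1 : E (cs.geometricRep u (E v)) = (2 * cs.geometricRep u (E v) o) • δ -
      cs.geometricRep (cs.longest J) (cs.geometricRep u (E v)) := rfl
    rw [h1, cs.parabolic_apply_of_notMem hu ho, hEo]
    simp only [hEdef, map_sub, map_smul, hδw]
    module
  · apply cs.geometricRep_injective
    ext1 v
    rw [hσ, geometricRep_mul_apply, geometricRep_mul_apply,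
      cs.translations_inv_apply hM hδ hδo ht]
    have h1 : cs.geometricRep t (E v) = E v - (cs.geometricRep t
        (cs.geometricRep (cs.longest J) v) o - cs.geometricRep (cs.longest J) v o) • δ := by
      have h2 := cs.translations_apply hM hδ hδo ht (cs.geometricRep (cs.longest J) v)
      have h3 : cs.geometricRep t (E v) = (2 * v o) • δ -
          cs.geometricRep t (cs.geometricRep (cs.longest J) v) := by
        rw [hEdef, map_sub, map_smul, hδw]
      rw [h3]
      nth_rewrite 1 [h2]
      rw [hEdef]
      module
    have h4 : E δ = δ := by
      simp only [hEdef, hδo, hδw]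
      module
    rw [h1, hlin, hE, h4, map_sub, map_smul, hδw, longest_apply_apply cs hfin]
  · have hsub : σ.toMulEquiv '' (cs.simple '' J) ⊆ cs.simple '' J := by
      rintro _ ⟨_, ⟨j, hj, rfl⟩, rfl⟩
      exact ⟨τ j, hτJ j hj, (hσs j).symm⟩
    refine Set.Subset.antisymm hsub ?_
    intro w hw
    exact ⟨σ.toMulEquiv w, hsub ⟨w, hw, rfl⟩, σ.involutive w⟩

/-! ### Dominant translations -/

section Translations

variable (hM : M.IsIrreducibleAffine)
include hM

/-- Since `t⁻¹ v = v + (v - t v)`, no positive root is made negative by both `t` and `t⁻¹`. -/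
theorem length_translation_sq {t : W} (ht : t ∈ cs.translations) :
    cs.length (t * t) = cs.length t + cs.length t := by
  obtain ⟨o⟩ := hM.connected.nonempty
  obtain ⟨δ, hδ, -, hδo⟩ := M.exists_radical hM o
  refine cs.length_mul_eq_add t t fun v _ h0 h1 => ?_
  have h2 := cs.translations_apply hM hδ hδo ht v
  have h3 := cs.translations_inv_apply hM hδ hδo ht v
  have h4 : cs.geometricRep t⁻¹ v = v + (v - cs.geometricRep t v) := by
    rw [h3]
    nth_rewrite 2 [h2]
    module
  rw [h4]
  exact add_nonneg h0 (sub_nonneg.mpr (h1.trans h0))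

variable (hJ : J ≠ Set.univ)
include hJ

/-- Roots inverted by `w_J` have coordinate `0` at `o`, so for them dominance of `t` says that `t⁻¹`
adds a nonnegative multiple of `δ`; `t²` doubles it. -/
theorem sq_mem_dominantTranslations {t : W} (ht : t ∈ cs.dominantTranslations J) :
    t * t ∈ cs.dominantTranslations J := by
  have hfin := cs.parabolic_finite hM hJ
  obtain ⟨o, ho⟩ := (Set.ne_univ_iff_exists_notMem J).mp hJ
  obtain ⟨δ, hδ, hpos, hδo⟩ := M.exists_radical hM o
  refine ⟨mul_mem ht.1 ht.1, cs.length_mul_eq_add _ _ fun v hv h0 h1 => ?_⟩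
  have h2 := cs.nonneg_of_length_mul_eq_add ht.2 hv h0 h1
  have hvo := cs.support_of_longest_apply_nonpos hfin h0 h1 ho
  have h3 := cs.translations_inv_apply hM hδ hδo ht.1 v
  have h4 := h2 o
  rw [h3, Pi.sub_apply, Pi.smul_apply, hvo, hδo] at h4
  have h5 : cs.geometricRep (t * t)⁻¹ v =
      v + (2 * - (cs.geometricRep t v o - v o)) • δ := by
    rw [mul_inv_rev, geometricRep_mul_apply, h3, map_sub, map_smul,
      cs.geometricRep_radical _ _ hδ, h3]
    module
  rw [h5]
  refine add_nonneg h0 (smul_nonneg ?_ fun k => (hpos k).le)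
  simp only [Pi.zero_apply, smul_eq_mul, hvo] at h4 ⊢
  linarith

/-- An element that is maximal in its double coset of `W_J` is `w_J t` with a translation `t`. -/
theorem exists_eq_longest_mul
    (hW : ∀ w : W, ∃ u ∈ cs.parabolic J, ∃ t ∈ cs.translations, w = u * t) {x : W}
    (hl : x ∈ cs.leftMaximal J) (hr : x ∈ cs.rightMaximal J) :
    ∃ t ∈ cs.dominantTranslations J, x = cs.longest J * t := by
  have hfin := cs.parabolic_finite hM hJ
  obtain ⟨o, ho⟩ := (Set.ne_univ_iff_exists_notMem J).mp hJ
  obtain ⟨δ, hδ, hpos, hδo⟩ := M.exists_radical hM o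
  obtain ⟨v, hv, t, ht, rfl⟩ := hW x
  suffices h : v⁻¹ = cs.longest J by
    rw [inv_eq_iff_eq_inv, longest_inv cs hfin] at h
    subst h
    refine ⟨t, ⟨ht, ?_⟩, rfl⟩
    rw [leftMaximal, Set.mem_ofPred_eq, longest_mul_cancel_left cs hfin] at hl
    exact hl
  rw [mem_leftMaximal_iff cs hfin] at hl
  rw [mem_rightMaximal_iff cs hfin] at hr
  refine cs.eq_longest hfin (inv_mem hv) fun j hj => ?_
  -- If `β = v⁻¹ α_j` were positive, right maximality would give `(t β)_o ≤ 0`, hence `t⁻¹ β = β -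
  -- (t β)_o δ ≥ 0`, while left maximality gives `t⁻¹ β ≤ 0`.
  refine (cs.geometricRep_single_nonneg_or_nonpos v⁻¹ j).resolve_left fun h0 => ?_
  set β := cs.geometricRep v⁻¹ (Pi.single j 1) with hβ
  have hβJ : ∀ k ∉ J, β k = 0 := fun k hk =>
    cs.parabolic_apply_single_of_notMem (inv_mem hv) hj hk
  have h1 := cs.geometricRep_nonpos_of_support
    (fun k hk => cs.isRightDescent_iff_nonpos.mp (hr k hk)) h0 hβJ o
  rw [geometricRep_mul_apply, cs.parabolic_apply_of_notMem hv ho, Pi.zero_apply] at h1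
  have h2 := cs.isLeftDescent_iff_nonpos.mp (hl j hj)
  rw [mul_inv_rev, geometricRep_mul_apply, ← hβ] at h2
  refine cs.geometricRep_single_ne_zero v⁻¹ j ((cs.geometricRep t⁻¹).injective ?_)
  rw [map_zero, ← hβ]
  refine le_antisymm h2 ?_
  rw [cs.translations_inv_apply hM hδ hδo ht, hβJ o ho, sub_eq_add_neg, ← neg_smul]
  exact add_nonneg h0 (smul_nonneg (by linarith) fun k => (hpos k).le)

end Translations

/-! ### The elements `w_J t` and their images under `π` -/

section Opposition

variable {cs} {σ : cs.DiagramInvolution} (hσ : cs.IsOpposition J σ.toMulEquiv)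
  (hfin : (cs.parabolic J : Set W).Finite)
include hσ hfin

theorem IsOpposition.map_longest_mul {t : W} (ht : t ∈ cs.translations) :
    σ.toMulEquiv (cs.longest J * t) = (cs.longest J * t)⁻¹ := by
  rw [map_mul, hσ.1 _ (cs.longest_mem hfin), hσ.2 t ht, mul_inv_rev, longest_inv cs hfin,
    longest_mul_self cs hfin, one_mul, ← mul_assoc, longest_mul_cancel_left cs hfin]

/-- The element is the inverse of `t^*`, and both inversion and `*` preserve length. -/
theorem IsOpposition.length_longest_mul_mul_longest {t : W} (ht : t ∈ cs.translations) :
    cs.length (cs.longest J * t * cs.longest J) = cs.length t := by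
  rw [← σ.length_apply t, hσ.2 t ht, ← length_inv]
  simp only [mul_inv_rev, longest_inv cs hfin, mul_assoc]

theorem IsOpposition.longest_mul_mem {t : W} (ht : t ∈ cs.dominantTranslations J) :
    cs.longest J * t ∈ cs.leftMaximal J ∩ cs.rightMaximal J := by
  constructor
  · rw [leftMaximal, Set.mem_ofPred_eq, longest_mul_cancel_left cs hfin]
    exact ht.2
  · rw [rightMaximal, Set.mem_ofPred_eq, hσ.length_longest_mul_mul_longest hfin ht.1]
    exact ht.2

theorem IsOpposition.demazureSquare_longest_mul (hM : M.IsIrreducibleAffine)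
    (hJ : J ≠ Set.univ) {t : W} (ht : t ∈ cs.dominantTranslations J) :
    σ.demazureSquare (cs.longest J * t) = cs.longest J * t ^ 2 := by
  set w := cs.longest J with hw
  have h1 : cs.demazure w t = w * t := cs.demazure_eq_mul ht.2
  have h2 : cs.demazure (w * t * w) w = w * t := by
    rw [demazure_eq_mul, longest_mul_cancel_right cs hfin]
    rw [longest_mul_cancel_right cs hfin, hσ.length_longest_mul_mul_longest hfin ht.1, ht.2,
      add_comm]
  have h3 : cs.demazure w w = w :=
    cs.demazure_of_mem_parabolic hfin (cs.longest_mem hfin) (cs.longest_mem_leftMaximal hfin)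
  rw [DiagramInvolution.demazureSquare, hσ.map_longest_mul hfin ht.1, inv_inv]
  calc cs.demazure (w * t) (w * t)
      = cs.demazure (cs.demazure (w * t * w) w) (cs.demazure w t) := by rw [h1, h2]
    _ = cs.demazure (cs.demazure (w * t * w) (cs.demazure w w)) t := by
        rw [demazure_assoc, demazure_assoc, demazure_assoc]
    _ = cs.demazure w (cs.demazure t t) := by rw [h3, h2, ← h1, demazure_assoc]
    _ = w * t ^ 2 := by
        rw [cs.demazure_eq_mul (cs.length_translation_sq hM ht.1),
          cs.demazure_eq_mul (cs.sq_mem_dominantTranslations hM hJ ht).2, sq]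

theorem IsOpposition.leftMaximal_inter_subset (hM : M.IsIrreducibleAffine) (hJ : J ≠ Set.univ)
    (hW : ∀ w : W, ∃ u ∈ cs.parabolic J, ∃ t ∈ cs.translations, w = u * t) :
    cs.leftMaximal J ∩ cs.rightMaximal J ⊆ σ.twistedInvolutions := by
  rintro x ⟨hl, hr⟩
  obtain ⟨t, ht, rfl⟩ := cs.exists_eq_longest_mul hM hJ hW hl hr
  exact hσ.map_longest_mul hfin ht.1

end Opposition

theorem DiagramInvolution.pi_mem_of_mem_leftMaximal {cs : CoxeterSystem M W}
    {σ : cs.DiagramInvolution} (hfin : (cs.parabolic J : Set W).Finite)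
    (hσJ : σ.toMulEquiv '' (cs.simple '' J) = cs.simple '' J) {w : W}
    (hw : w ∈ cs.leftMaximal J) : (σ.pi w : W) ∈ cs.leftMaximal J ∩ cs.rightMaximal J := by
  have hl : (σ.pi w : W) ∈ cs.leftMaximal J := by
    rw [σ.pi_eq_demazureSquare]
    exact cs.demazure_mem_leftMaximal hfin hw _
  refine ⟨hl, ?_⟩
  rw [mem_leftMaximal_iff cs hfin] at hl
  rw [mem_rightMaximal_iff cs hfin]
  intro j hj
  obtain ⟨_, ⟨k, hk, rfl⟩, hkj⟩ := hσJ.ge ⟨j, hj, rfl⟩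
  exact (σ.isRightDescent_iff_of_mem (σ.pi w).2 hkj).mpr (hl k hk)

/-- Write `x = v ∘ (v^*)⁻¹`. As `w_J^* = w_J = w_J⁻¹`, the twisted square of `w_J ∘ v` is `w_J ∘ x ∘
w_J`, and `x` absorbs both factors. -/
theorem DiagramInvolution.exists_pi_eq {cs : CoxeterSystem M W} {σ : cs.DiagramInvolution}
    (hfin : (cs.parabolic J : Set W).Finite) (hσ : cs.IsOpposition J σ.toMulEquiv) {x : W}
    (hx : x ∈ σ.twistedInvolutions) (hl : x ∈ cs.leftMaximal J) (hr : x ∈ cs.rightMaximal J) :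
    ∃ w ∈ cs.leftMaximal J, (σ.pi w : W) = x := by
  obtain ⟨v, rfl⟩ := σ.exists_demazureSquare_eq hx
  have hm := cs.longest_mem hfin
  refine ⟨_, cs.demazure_mem_leftMaximal hfin (cs.longest_mem_leftMaximal hfin) v, ?_⟩
  have hr' : (σ.demazureSquare v)⁻¹ ∈ cs.leftMaximal J := by
    rw [mem_leftMaximal_iff cs hfin]
    rw [mem_rightMaximal_iff cs hfin] at hr
    simpa only [isLeftDescent_inv_iff] using hr
  have h1 := cs.demazure_of_mem_parabolic hfin hm hr'
  rw [← inv_inj, demazure_inv, inv_inv, longest_inv cs hfin] at h1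
  have h2 := cs.demazure_of_mem_parabolic hfin hm hl
  rw [σ.pi_eq_demazureSquare, demazureSquare, σ.map_demazure, hσ.1 _ hm, demazure_inv,
    longest_mul_cancel_right cs hfin, longest_inv cs hfin, demazure_assoc,
    ← cs.demazure_assoc v]
  change cs.demazure (cs.longest J) (cs.demazure (σ.demazureSquare v) (cs.longest J)) = _
  rw [h1, h2]

end CoxeterSystem

/-! ### The main theorem -/

theorem mainTheorem3 {B W : Type*} [Fintype B] [DecidableEq B] [Group W] {M : CoxeterMatrix B}
    (cs : CoxeterSystem M W) (hM : M.IsIrreducibleAffine) (J : Set B) (hJ : J ≠ Set.univ)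
    (hW : ∀ w : W, ∃ u ∈ cs.parabolic J, ∃ t ∈ cs.translations, w = u * t) :
    -- `W_J` is finite, so that it has a longest element
    (cs.parabolic J : Set W).Finite ∧
    -- there is a unique automorphism `*` as required; it has square `1` and preserves `S` and `J`
    ∃ σ : cs.DiagramInvolution,
      (∀ e : W ≃* W, cs.IsOpposition J e ↔ e = σ.toMulEquiv) ∧
      σ.toMulEquiv '' (cs.simple '' J) = cs.simple '' J ∧
      (cs.leftMaximal J ∩ cs.rightMaximal J ⊆ σ.twistedInvolutions) ∧
      -- the bijection `t ↦ [t]`, where `W_J t = W_J [t]`, the bijection `t ↦ w_J t`,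
      -- and the restriction of `π`
      ∃ (bracket : cs.translations ≃ cs.leftMaximal J)
        (dom : cs.dominantTranslations J ≃ ↑(cs.leftMaximal J ∩ cs.rightMaximal J))
        (piJ : cs.leftMaximal J → ↑(cs.leftMaximal J ∩ cs.rightMaximal J)),
        (∀ (t : cs.translations) (w : cs.leftMaximal J),
          bracket t = w ↔ (w : W) * (t : W)⁻¹ ∈ cs.parabolic J) ∧
        (∀ t : cs.dominantTranslations J, (dom t : W) = cs.longest J * t) ∧
        (∀ w : cs.leftMaximal J, (piJ w : W) = σ.pi w) ∧
        -- the induced map `π'` is surjective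
        Function.Surjective (fun t : cs.translations => dom.symm (piJ (bracket t))) ∧
        -- its values at the dominant translations
        ∀ (t : W) (ht : t ∈ cs.dominantTranslations J),
          (∃ h : cs.longest J * t ∈ cs.leftMaximal J,
            (piJ ⟨cs.longest J * t, h⟩ : W) = cs.longest J * t ^ 2) ∧
          (dom.symm (piJ (bracket ⟨t, ht.1⟩)) : W) = t ^ 2 := by
  have hfin := cs.parabolic_finite hM hJ
  refine ⟨hfin, ?_⟩
  obtain ⟨σ, hσ, hσJ⟩ := cs.exists_isOpposition hM hJ hW
  have hm := cs.longest_mem hfin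
  have hchoice : ∀ t : cs.translations, ∃ w : cs.leftMaximal J,
      (w : W) * (t : W)⁻¹ ∈ cs.parabolic J := fun t => by
    obtain ⟨u, hu, h⟩ := cs.exists_mul_mem_leftMaximal hfin (t : W)
    exact ⟨⟨_, h⟩, by simpa using hu⟩
  choose br hbr using hchoice
  have hbr_unique : ∀ (t : cs.translations) (w : cs.leftMaximal J),
      (w : W) * (t : W)⁻¹ ∈ cs.parabolic J → br t = w := fun t w h => by
    refine Subtype.ext (cs.leftMaximal_unique hfin (br t).2 w.2 ?_)
    have := mul_mem h (inv_mem (hbr t))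
    simpa [mul_assoc] using this
  have hbr_bij : Function.Bijective br := by
    constructor
    · intro t t' h
      have h1 := hbr t
      rw [h] at h1
      have h2 := mul_mem (inv_mem h1) (hbr t')
      have h3 : (t : W) * (t' : W)⁻¹ ∈ cs.parabolic J := by simpa [mul_assoc] using h2
      -- Injectivity of `t ↦ [t]` is the triviality of the intersection of `W_J` with the
      -- translations.
      have := cs.eq_one_of_mem_parabolic_of_mem_translations hM hJ h3 (mul_mem t.2 (inv_mem t'.2))
      exact Subtype.ext (mul_inv_eq_one.mp this)
    · rintro ⟨w, hw⟩
      obtain ⟨u, hu, t, ht, rfl⟩ := hW w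
      exact ⟨⟨t, ht⟩, hbr_unique _ _ (by simpa using hu)⟩
  let dm : cs.dominantTranslations J → ↑(cs.leftMaximal J ∩ cs.rightMaximal J) := fun t =>
    ⟨cs.longest J * t, hσ.longest_mul_mem hfin t.2⟩
  have hdm_bij : Function.Bijective dm := by
    constructor
    · intro t t' h
      exact Subtype.ext (mul_left_cancel (congrArg Subtype.val h))
    · rintro ⟨x, hl, hr⟩
      obtain ⟨t, ht, rfl⟩ := cs.exists_eq_longest_mul hM hJ hW hl hr
      exact ⟨⟨t, ht⟩, rfl⟩
  have hsub := hσ.leftMaximal_inter_subset hfin hM hJ hW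
  refine ⟨σ, fun e => ⟨fun h => cs.isOpposition_unique hW h hσ, by rintro rfl; exact hσ⟩, hσJ, hsub,
    Equiv.ofBijective br hbr_bij, Equiv.ofBijective dm hdm_bij,
    fun w => ⟨σ.pi w, CoxeterSystem.DiagramInvolution.pi_mem_of_mem_leftMaximal hfin hσJ w.2⟩,
    fun t w => ⟨by rintro rfl; exact hbr t, hbr_unique t w⟩, fun t => rfl, fun w => rfl, ?_, ?_⟩
  · intro t
    obtain ⟨w, hw, h⟩ := CoxeterSystem.DiagramInvolution.exists_pi_eq hfin hσ
      (hsub (dm t).2) (dm t).2.1 (dm t).2.2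
    obtain ⟨t', ht'⟩ := hbr_bij.2 ⟨w, hw⟩
    refine ⟨t', ?_⟩
    rw [Equiv.symm_apply_eq]
    refine Subtype.ext ?_
    simp only [Equiv.ofBijective_apply, ht']
    exact h
  · intro t ht
    have hpi : (σ.pi (cs.longest J * t) : W) = cs.longest J * t ^ 2 := by
      rw [σ.pi_eq_demazureSquare]
      exact hσ.demazureSquare_longest_mul hfin hM hJ ht
    have hmem := (hσ.longest_mul_mem hfin ht).1
    refine ⟨⟨hmem, hpi⟩, ?_⟩
    have hbrt : br ⟨t, ht.1⟩ = ⟨_, hmem⟩ := hbr_unique _ _ (by simpa using hm)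
    have hsq : t ^ 2 ∈ cs.dominantTranslations J := sq t ▸ cs.sq_mem_dominantTranslations hM hJ ht
    suffices h : (Equiv.ofBijective dm hdm_bij).symm
        ⟨σ.pi (br ⟨t, ht.1⟩), CoxeterSystem.DiagramInvolution.pi_mem_of_mem_leftMaximal hfin hσJ
          (br ⟨t, ht.1⟩).2⟩ = ⟨t ^ 2, hsq⟩ from congrArg Subtype.val h
    rw [Equiv.symm_apply_eq]
    refine Subtype.ext ?_
    simp only [hbrt]
    exact hpi
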